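/- Let $k\ge 1$ and let $L_1,\dots,L_k$ be non-negative integers with $L_1L_k\neq 0$. Assume that the polynomial $P=L_kX^k+\dots+L_1X-1$ has $k$ distinct complex roots $\beta_1,\dots,\beta_k$, where $\beta_1=\beta$ is real with $0<\beta<1$ and $|\beta_j|>1$ for $j=2,\dots,k$. *Partitions.* Let $\rho$ be the partition of $[0,1)$ into $L_1$ intervals of length $\beta$, followed by $L_2$ intervals of length $\beta^2$, ..., followed by $L_k$ intervals of length $\beta^k$. Starting from the trivial partition $\{[0,1)\}$, form a sequence of partitions by subdividing in each step all intervals of maximal length homothetically to $\rho$. Let $t_n=l_{n,0}$ be the number of all intervals of the $n$-th partition ($n\ge 0$) and let $l_{n,i}$ ($i\ge 1$) be the number of its intervals of length $\beta^{n+i-1}$; thus $l_{n,i}=0$ for $i>k$. *Digits.* For an integer $N\ge 1$ choose $n$ with $t_n\le N<t_{n+1}$. Put $N_n=N$, $T_n=t_n$, $\epsilon_n=1$, $\eta_n=\lfloor (N-T_n)/l_{n,1}\rfloor$. For $m=n-1,\dots,0$ let $j\ge 0$ be such that $\epsilon_{m+1}=\dots=\epsilon_{m+j}=0$ and $\epsilon_{m+j+1}\ne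 0$, and put $N_m=N_{m+1}-\epsilon_{m+1}T_{m+1}-\eta_{m+1}l_{m+1,1}$ and $T_m=l_{m,1}+\dots+l_{m,j+2}$; if $N_m<T_m$, put $\epsilon_m=\eta_m=0$, otherwise put $\epsilon_m=1$ and $\eta_m=\lfloor (N_m-T_m)/l_{m,1}\rfloor$. *Points.* The generalized $LS$-sequence of points $(\xi^N)_{N\ge 1}$ with parameters $L_1,\dots,L_k$ is given by $$\xi^N=\sum_{i=0}^n\sum_{r=1}^k\beta^{i+r}\bigl(\max\{\epsilon_i+\eta_i-L_1-\dots-L_{r-1},0\}-\max\{\epsilon_i+\eta_i-L_1-\dots-L_r,0\}\bigr).$$ *Constants.* For $1\le j\le k$ and $0\le i\le k$ let $\lambda_{j,i}$ be the quotient $\det V_{j,i}/\det V$, where $V$ is the $k\times k$ matrix with rows $(\beta_1^{-r},\dots,\beta_k^{-r})$, $r=0,\dots,k-1$, and $V_{j,i}$ arises from $V$ by replacing its $j$-th column by $(l_{0,i},\dots,l_{k-1,i})^T$. (So $\lambda_{1,i},\dots,\lambda_{k,i}$ solve the linear system $\sum_{j}\lambda_{j,i}\beta_j^{-n}=l_{n,i}$,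 $0\le n\le k-1$.) For $2\le j\le k$ let $$\Lambda_j=\max_{\ell=2,\dots,k}\frac{\sum_{i=1}^{\ell}|\lambda_{j,i}|+(L_1+\dots+L_k-2)|\lambda_{j,1}|}{1-|\beta_j|^{-1}},\qquad \tilde R=1+|\lambda_{1,0}|+\sum_{j=2}^k\bigl(2\Lambda_j+|\lambda_{j,0}|\bigr).$$ *Discrepancy.* Let $$D_N=\sup_{0\le a<b\le 1}\Bigl|\frac1N\#\{1\le n\le N:\xi^n\in[a,b)\}-(b-a)\Bigr|.$$ **Theorem.** For all sufficiently large $N$, $$D_N\le\frac{\log(N+1)-\log|\lambda_{1,0}\beta^k|}{N|\log\beta|}\,(2L_1+L_2+\dots+L_k-2)\,\tilde R .$$ In particular, $D_N=O(N^{-1}\log N)$ as $N\to\infty$, that is, the sequence is low-discrepancy. -/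

import Mathlib

noncomputable section

namespace GenLS

/-! Parameters: `k`, the sequence `L` (only `L 1, …, L k` matter) and the real number `β`. -/

/-- The polynomial `L_k X^k + … + L_1 X - 1`. -/
def lsPoly (k : ℕ) (L : ℕ → ℕ) : Polynomial ℂ :=
  (∑ i ∈ Finset.Icc 1 k, Polynomial.C (L i : ℂ) * Polynomial.X ^ i) - 1

/-! ### Partitions

A finite partition of `[0,1)` into half-open intervals is recorded by the list of the lengths of its
intervals, from left to right. -/

open Classical in
/-- The `ρ`-refinement of `π`: every interval of maximal length is subdivided homothetically to
`ρ`. -/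
def refinement (ρ π : List ℝ) : List ℝ :=
  π.flatMap fun s => if ∀ u ∈ π, u ≤ s then ρ.map (fun r => s * r) else [s]

/-- The partition `ρ_{L_1,…,L_k}`: `L_1` intervals of length `β`, then `L_2` intervals of length
`β ^ 2`, …, then `L_k` intervals of length `β ^ k`. -/
def lsBlock (k : ℕ) (L : ℕ → ℕ) (β : ℝ) : List ℝ :=
  (List.range k).flatMap fun i => List.replicate (L (i + 1)) (β ^ (i + 1))

/-- The generalized `LS`-sequence of partitions: the successive `ρ_{L_1,…,L_k}`-refinements of the
trivial partition `{[0,1)}`. -/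
def lsPartition (k : ℕ) (L : ℕ → ℕ) (β : ℝ) (n : ℕ) : List ℝ :=
  (refinement (lsBlock k L β))^[n] [1]

/-- `l_{n,0} = t_n` is the number of all intervals of the `n`-th partition, and for `i ≥ 1` the
number `l_{n,i}` is the number of its intervals of length `β ^ (n + i - 1)` (there is none if
`i > k`). -/
def lsCount (k : ℕ) (L : ℕ → ℕ) (β : ℝ) (n i : ℕ) : ℕ :=
  if i = 0 then (lsPartition k L β n).length
  else (lsPartition k L β n).count (β ^ (n + i - 1))

end GenLS

end

namespace GenLS

/-! ### The numeration system attached to the numbers `l n i` -/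

/-- The quantities `N_m`, `T_m`, `ε_m`, `η_m` of the digit algorithm at an index `m`, together with
the number `zeros` of consecutive vanishing digits `ε_m = ε_{m+1} = … = 0` that start at `m`. -/
structure DigitState where
  rem : ℕ
  T : ℕ
  eps : ℕ
  eta : ℕ
  zeros : ℕ

/-- The number `n` with `t_n ≤ N < t_{n+1}` (for `N ≥ 1`; recall `t_n = l n 0` and `n < t_n`). -/
def topIndex (l : ℕ → ℕ → ℕ) (N : ℕ) : ℕ :=
  Nat.findGreatest (fun m => l m 0 ≤ N) N

/-- The quantities at the top index `n`. -/
def topState (l : ℕ → ℕ → ℕ) (N n : ℕ) : DigitState where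
  rem := N
  T := l n 0
  eps := 1
  eta := (N - l n 0) / l n 1
  zeros := 0

/-- Given the quantities `s` at the index `m + 1`, the quantities at the index `m`. The number
`j = s.zeros` satisfies `ε_{m+1} = … = ε_{m+j} = 0` and `ε_{m+j+1} ≠ 0`. -/
def nextState (l : ℕ → ℕ → ℕ) (m : ℕ) (s : DigitState) : DigitState :=
  let r := s.rem - s.eps * s.T - s.eta * l (m + 1) 1
  let T := ∑ i ∈ Finset.Icc 1 (s.zeros + 2), l m i
  if r < T then ⟨r, T, 0, 0, s.zeros + 1⟩
  else ⟨r, T, 1, (r - T) / l m 1, 0⟩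

/-- The quantities at the index `n - d`, when the algorithm starts at the index `n`. -/
def stateDown (l : ℕ → ℕ → ℕ) (N n : ℕ) : ℕ → DigitState
  | 0 => topState l N n
  | d + 1 => nextState l (n - (d + 1)) (stateDown l N n d)

/-- The quantities at the index `m ≤ n` for the integer `N`, where `t_n ≤ N < t_{n+1}`. -/
def digitState (l : ℕ → ℕ → ℕ) (N m : ℕ) : DigitState :=
  stateDown l N (topIndex l N) (topIndex l N - m)

end GenLS

noncomputable section

namespace GenLS

/-! ### The generalized `LS`-sequence of points -/

/-- The contribution of the digit `c = ε_i + η_i` at the index `i`: the sum over `r = 1, …, k` of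
`β ^ (i + r)` times `max (c - L_1 - … - L_{r-1}) 0 - max (c - L_1 - … - L_r) 0`. Truncated
subtraction of natural numbers expresses the maxima. The coefficient for `r = 1` is `min L_1 c`, and
the subtracted term for `r = k` vanishes since `c < L_1 + … + L_k`. -/
def digitPoint (k : ℕ) (L : ℕ → ℕ) (β : ℝ) (i c : ℕ) : ℝ :=
  ∑ r ∈ Finset.Icc 1 k, β ^ (i + r) *
    (((c - ∑ q ∈ Finset.Icc 1 (r - 1), L q : ℕ) : ℝ) - ((c - ∑ q ∈ Finset.Icc 1 r, L q : ℕ) : ℝ))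

/-- The `N`-th point (`N ≥ 1`) of the generalized `LS`-sequence of points. -/
def lsPoint (k : ℕ) (L : ℕ → ℕ) (β : ℝ) (N : ℕ) : ℝ :=
  ∑ i ∈ Finset.range (topIndex (lsCount k L β) N + 1),
    digitPoint k L β i
      ((digitState (lsCount k L β) N i).eps + (digitState (lsCount k L β) N i).eta)

/-! ### Discrepancy -/

/-- The discrepancy `D_N` of the first `N` points `x 1, …, x N` of a sequence. -/
def discrepancy (x : ℕ → ℝ) (N : ℕ) : ℝ :=
  sSup {d : ℝ | ∃ a b : ℝ, 0 ≤ a ∧ a < b ∧ b ≤ 1 ∧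
    d = |(1 / (N : ℝ)) * ∑ n ∈ Finset.Icc 1 N, (Set.Ico a b).indicator (fun _ => (1 : ℝ)) (x n)
      - (b - a)|}

/-! ### The constants

Here `b 1, …, b k` is an enumeration of the roots of `lsPoly k L`. -/

/-- The matrix with rows `(b_1^{-r}, …, b_k^{-r})` for `r = 0, …, k - 1`. -/
def rootMatrix (k : ℕ) (b : ℕ → ℂ) : Matrix (Fin k) (Fin k) ℂ :=
  Matrix.of fun r c => b (c + 1) ^ (-(r : ℤ))

/-- The matrix `rootMatrix k b` with its `j`-th column (`1 ≤ j ≤ k`) replaced by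
`(l_{0,i}, …, l_{k-1,i})`. -/
def rootMatrixRepl (k : ℕ) (L : ℕ → ℕ) (β : ℝ) (b : ℕ → ℂ) (j i : ℕ) :
    Matrix (Fin k) (Fin k) ℂ :=
  Matrix.of fun r c =>
    if (c : ℕ) + 1 = j then (lsCount k L β r i : ℂ) else b (c + 1) ^ (-(r : ℤ))

/-- The constant `λ_{j,i}`, by Cramer's rule. -/
def lam (k : ℕ) (L : ℕ → ℕ) (β : ℝ) (b : ℕ → ℂ) (j i : ℕ) : ℂ :=
  (rootMatrixRepl k L β b j i).det / (rootMatrix k b).det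

/-- The constant `Λ_j`; the supremum is the maximum over `ℓ = 2, …, k`. -/
def bigLam (k : ℕ) (L : ℕ → ℕ) (β : ℝ) (b : ℕ → ℂ) (j : ℕ) : ℝ :=
  ⨆ ℓ : Finset.Icc 2 k,
    ((∑ i ∈ Finset.Icc 1 (ℓ : ℕ), ‖lam k L β b j i‖)
        + ((∑ i ∈ Finset.Icc 1 k, (L i : ℝ)) - 2) * ‖lam k L β b j 1‖)
      / (1 - ‖b j‖⁻¹)

/-- The constant `R̃`. -/
def bigR (k : ℕ) (L : ℕ → ℕ) (β : ℝ) (b : ℕ → ℂ) : ℝ :=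
  1 + ‖lam k L β b 1 0‖
    + ∑ j ∈ Finset.Icc 2 k, (2 * bigLam k L β b j + ‖lam k L β b j 0‖)

end GenLS

end

/-! ### Recurrences for the interval counts -/

namespace GenLS

/-! The partitions are self-similar: inside an interval of length `β ^ r` of the `r`-th partition,
the `(r+j)`-th partition is a scaled copy of the `j`-th one. The points inherit this structure. The
digit algorithm unrolls a recursion (`enum`) that lists the old left endpoints first and then
appends translates of the left endpoints of the longest intervals, one translate for each further
piece of `ρ` (`IsParam.enum_stateDown`, `IsParam.lsPoint_eq_enum`).

The counts satisfy a linear recurrence whose eigenvalues are the inverses of the roots, so `l_{n,i}`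
is a combination of the `β_j ^ (-n)` with coefficients `λ_{j,i}` (`IsParam.lsCount_eq_sum_lam`). A
complete block of points puts `l_{j,1} + … + l_{j,i}` points into the interval
(`IsParam.hits_full`). Against the expected number the term of `β` cancels, and the other roots
leave an error that decays geometrically in `j`. An arbitrary initial segment of points splits into
complete blocks, boundedly many per level, and one incomplete block that passes to the level below.
Summing the geometric series bounds the error in every such interval by `R̃ - 1`, uniformly in `r`
and `N` (`IsRoots.hits_error_le`).

For an arbitrary `[u, v)`, write it as a difference of `[0, v)` and `[0, u)` and exhaust each of
these by such intervals. On average `K / 2` of them per level suffice, where `K = 2 L_1 + L_2 + … +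
L_k - 2` (`IsParam.digit_le`, `IsRoots.countError_initial`). About `n + k` levels occur when `t_n ≤
N < t_{n+1}`, and `t_n ~ |λ_{1,0}| β ^ (-n)` turns this number into the logarithmic factor
(`IsRoots.eventually_levels`). The bounded leftovers are absorbed by the gap between `R̃ - 1` and
`R̃`. -/

/-- The standing assumptions on `k`, `L` and `β`: the root condition is `∑ L_i β ^ i = 1`. -/
structure IsParam (k : ℕ) (L : ℕ → ℕ) (β : ℝ) : Prop where
  one_le : 1 ≤ k
  first_ne : L 1 ≠ 0
  pos : 0 < β
  lt_one : β < 1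
  sum_eq : ∑ i ∈ Finset.Icc 1 k, (L i : ℝ) * β ^ i = 1

/-- The number `L_i`, read as `0` for `i > k`. -/
def coef (k : ℕ) (L : ℕ → ℕ) (i : ℕ) : ℕ := if i ≤ k then L i else 0

variable {k : ℕ} {L : ℕ → ℕ} {β : ℝ}

theorem IsParam.pow_inj (h : IsParam k L β) {m n : ℕ} : β ^ m = β ^ n ↔ m = n :=
  (pow_right_strictAnti₀ h.pos h.lt_one).injective.eq_iff

theorem IsParam.count_block (h : IsParam k L β) (i : ℕ) (hi : 1 ≤ i) :
    (lsBlock k L β).count (β ^ i) = coef k L i := by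
  obtain ⟨i, rfl⟩ := Nat.exists_eq_add_of_le' hi
  simp only [lsBlock, List.count_flatMap, Function.comp_def, List.count_replicate, beq_iff_eq,
    h.pow_inj, add_left_inj]
  change ∑ j ∈ Finset.range k, (if j = i then L (j + 1) else 0) = _
  rw [Finset.sum_ite_eq']
  simp [coef]

theorem lsPartition_succ (k : ℕ) (L : ℕ → ℕ) (β : ℝ) (n : ℕ) :
    lsPartition k L β (n + 1) = refinement (lsBlock k L β) (lsPartition k L β n) :=
  Function.iterate_succ_apply' _ _ _

theorem mem_lsBlock {s : ℝ} (hs : s ∈ lsBlock k L β) : ∃ i < k, s = β ^ (i + 1) := by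
  simp only [lsBlock, List.mem_flatMap, List.mem_range, List.mem_replicate] at hs
  obtain ⟨i, hi, -, rfl⟩ := hs
  exact ⟨i, hi, rfl⟩

theorem IsParam.mem_lsBlock_one (h : IsParam k L β) : β ∈ lsBlock k L β := by
  simp only [lsBlock, List.mem_flatMap, List.mem_range, List.mem_replicate]
  exact ⟨0, h.one_le, h.first_ne, by simp⟩

/-- If the longest intervals of `π` have length `β ^ n`, exactly these are subdivided. -/
theorem IsParam.refinement_eq (h : IsParam k L β) {π : List ℝ} {n : ℕ}
    (h1 : ∀ s ∈ π, ∃ i < k, s = β ^ (n + i)) (h2 : β ^ n ∈ π) (ρ : List ℝ) :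
    refinement ρ π = π.flatMap fun s => if s = β ^ n then ρ.map (fun r => s * r) else [s] := by
  classical
  unfold refinement
  refine List.flatMap_congr fun s hs => ?_
  have : (∀ u ∈ π, u ≤ s) ↔ s = β ^ n := by
    constructor
    · intro hu
      obtain ⟨i, -, rfl⟩ := h1 s hs
      exact le_antisymm (pow_le_pow_of_le_one h.pos.le h.lt_one.le (by omega)) (hu _ h2)
    · rintro rfl u hu
      obtain ⟨i, -, rfl⟩ := h1 u hu
      exact pow_le_pow_of_le_one h.pos.le h.lt_one.le (by omega)
  simp only [this]

/-- Invariant that identifies the intervals to be cut: the maximal length of the `n`-th partition is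
exactly `β ^ n`. It persists because `L 1 ≠ 0`, so a cut always produces an interval of length `β ^
(n + 1)`. -/
theorem IsParam.lsPartition_mem (h : IsParam k L β) (n : ℕ) :
    (∀ s ∈ lsPartition k L β n, ∃ i < k, s = β ^ (n + i)) ∧ β ^ n ∈ lsPartition k L β n := by
  induction n with
  | zero =>
    simp only [lsPartition, Function.iterate_zero, id, List.mem_singleton]
    exact ⟨fun s hs => ⟨0, h.one_le, by simp [hs]⟩, by simp⟩
  | succ n ih =>
    rw [lsPartition_succ, h.refinement_eq ih.1 ih.2]
    simp only [List.mem_flatMap]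
    refine ⟨?_, β ^ n, ih.2, ?_⟩
    · rintro s ⟨u, hu, hs⟩
      split_ifs at hs with hun
      · obtain ⟨r, hr, rfl⟩ := List.mem_map.1 hs
        obtain ⟨i, hi, rfl⟩ := mem_lsBlock hr
        exact ⟨i, hi, by rw [hun]; ring⟩
      · rw [List.mem_singleton] at hs
        obtain ⟨i, hi, rfl⟩ := ih.1 u hu
        cases i with
        | zero => simp at hun
        | succ i => exact ⟨i, by omega, by rw [hs]; congr 1; ring⟩
    · rw [if_pos rfl, List.mem_map]
      exact ⟨β, h.mem_lsBlock_one, by ring⟩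

theorem IsParam.lsCount_zero (h : IsParam k L β) (i : ℕ) (hi : 1 ≤ i) :
    lsCount k L β 0 i = if i = 1 then 1 else 0 := by
  have : (1 : ℝ) = β ^ 0 := by simp
  simp only [lsCount, lsPartition, Function.iterate_zero, id]
  rw [if_neg (by omega), List.count_singleton, this]
  simp only [beq_iff_eq, h.pow_inj]
  congr 1
  simp; omega

/-- An interval of length `β ^ (n + i)` is either left over from the previous partition or one of
the pieces cut from a longest interval. -/
theorem IsParam.lsCount_succ (h : IsParam k L β) (n i : ℕ) (hi : 1 ≤ i) :
    lsCount k L β (n + 1) i = lsCount k L β n (i + 1) + coef k L i * lsCount k L β n 1 := by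
  have hm := h.lsPartition_mem n
  simp only [lsCount, if_neg (show i ≠ 0 by omega), if_neg (Nat.succ_ne_zero _)]
  rw [lsPartition_succ, h.refinement_eq hm.1 hm.2, show n + (i + 1) - 1 = n + i by omega,
    show n + 1 + i - 1 = n + i by omega, show n + 1 - 1 = n by omega]
  generalize lsPartition k L β n = π
  induction π with
  | nil => simp
  | cons s π ih =>
    rw [List.flatMap_cons, List.count_append, ih, List.count_cons, List.count_cons]
    simp only [beq_iff_eq]
    by_cases hs : s = β ^ n
    · have inj : Function.Injective (fun r : ℝ => β ^ n * r) :=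
        mul_right_injective₀ (pow_pos h.pos n).ne'
      have hc := List.count_map_of_injective (lsBlock k L β) _ inj (β ^ i)
      rw [h.count_block i hi] at hc
      have hne : β ^ n ≠ β ^ (n + i) := by rw [Ne, h.pow_inj]; omega
      subst hs
      rw [if_pos rfl, if_neg hne, if_pos rfl, pow_add, hc]
      ring
    · rw [if_neg hs, if_neg hs, List.count_singleton]
      simp only [beq_iff_eq]
      ring

theorem IsParam.lsCount_of_lt (h : IsParam k L β) (n i : ℕ) (hi : k < i) :
    lsCount k L β n i = 0 := by
  rw [lsCount, if_neg (by omega), List.count_eq_zero]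
  intro hm
  obtain ⟨j, hj, e⟩ := (h.lsPartition_mem n).1 _ hm
  rw [h.pow_inj] at e
  omega

theorem IsParam.lsCount_total (h : IsParam k L β) (n : ℕ) :
    lsCount k L β n 0 = ∑ i ∈ Finset.Icc 1 k, lsCount k L β n i := by
  classical
  have hm := h.lsPartition_mem n
  have key := Multiset.sum_count_eq_card (s := (Finset.Icc 1 k).image fun i => β ^ (n + i - 1))
    (m := (lsPartition k L β n : Multiset ℝ)) (by
      intro a ha
      obtain ⟨i, hi, rfl⟩ := hm.1 a ha
      exact Finset.mem_image.2 ⟨i + 1, by simp; omega, by congr 1⟩)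
  rw [Finset.sum_image] at key
  · rw [lsCount, if_pos rfl]
    rw [Multiset.coe_card] at key
    rw [← key]
    refine Finset.sum_congr rfl fun i hi => ?_
    rw [lsCount, if_neg (by simp at hi; omega), Multiset.coe_count]
  · intro i hi j hj e
    simp only [Finset.coe_Icc, Set.mem_Icc] at hi hj
    simp only [h.pow_inj] at e
    omega

theorem IsParam.lsCount_one_pos (h : IsParam k L β) (n : ℕ) : 0 < lsCount k L β n 1 := by
  rw [lsCount, if_neg one_ne_zero, List.count_pos_iff]
  exact (h.lsPartition_mem n).2

end GenLS

/-! ### The explicit formula for the interval counts -/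

namespace GenLS

variable {k : ℕ} {L : ℕ → ℕ} {β : ℝ} {b : ℕ → ℂ}

/-- For `x = β` this says that the lengths add up to 1. In general `(1, x, …, x ^ (k-1))` is a left
eigenvector of the recurrence with eigenvalue `x⁻¹`, precisely because `x` is a root. -/
theorem IsParam.sum_pow_mul_lsCount (h : IsParam k L β) {x : ℂ}
    (hx : ∑ i ∈ Finset.Icc 1 k, (L i : ℂ) * x ^ i = 1) (n : ℕ) :
    ∑ i ∈ Finset.range k, x ^ i * (lsCount k L β n (i + 1) : ℂ) = x⁻¹ ^ n := by
  have hx0 : x ≠ 0 := by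
    rintro rfl
    rw [Finset.sum_eq_zero] at hx
    · simp at hx
    · intro i hi
      rw [Finset.mem_Icc] at hi
      rw [zero_pow (by omega), mul_zero]
  induction n with
  | zero =>
    rw [Finset.sum_eq_single 0]
    · simp [h.lsCount_zero]
    · intro i _ hi
      rw [h.lsCount_zero _ (by omega), if_neg (by omega)]; simp
    · have := h.one_le
      simp; omega
  | succ n ih =>
    have e1 : ∑ i ∈ Finset.range k, x ^ (i + 1) * (coef k L (i + 1) : ℂ) = 1 := by
      rw [← hx, Finset.range_eq_Ico, Finset.sum_Ico_add' (fun i => x ^ i * (coef k L i : ℂ)) 0 k 1]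
      refine Finset.sum_congr (by ext; simp) fun i hi => ?_
      rw [coef, if_pos (by simp at hi; omega), mul_comm]
    have e2 := Finset.sum_range_succ' (fun i => x ^ i * (lsCount k L β n (i + 1) : ℂ)) k
    rw [Finset.sum_range_succ, ih, h.lsCount_of_lt n (k + 1) (by omega)] at e2
    simp only [Nat.cast_zero, mul_zero, add_zero, pow_zero, one_mul, zero_add] at e2
    have e3 : x * ∑ i ∈ Finset.range k, x ^ i * (lsCount k L β (n + 1) (i + 1) : ℂ) = x⁻¹ ^ n := by
      rw [e2, Finset.mul_sum, ← one_mul (lsCount k L β n 1 : ℂ), ← e1, Finset.sum_mul,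
        ← Finset.sum_add_distrib]
      refine Finset.sum_congr rfl fun i _ => ?_
      rw [h.lsCount_succ _ _ (by omega)]
      push_cast
      ring
    rw [pow_succ, ← e3]
    field_simp

theorem rootMatrix_det_ne_zero (hinj : Set.InjOn b (Finset.Icc 1 k)) :
    (rootMatrix k b).det ≠ 0 := by
  have : rootMatrix k b = (Matrix.vandermonde fun c : Fin k => (b (c + 1))⁻¹).transpose := by
    ext r c
    simp [rootMatrix, Matrix.vandermonde]
  rw [this, Matrix.det_transpose, Matrix.det_vandermonde_ne_zero_iff]
  intro c d e
  have := hinj (by simp) (by simp) (inv_injective e)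
  ext; omega

/-- The constants `λ_{j,i}` are determined by any representation of `l_{n,i}`. -/
theorem lam_eq_of_forall (hinj : Set.InjOn b (Finset.Icc 1 k)) {i : ℕ} {U : Fin k → ℂ}
    (hU : ∀ n, (lsCount k L β n i : ℂ) = ∑ c, U c * (b (c + 1))⁻¹ ^ n) (c : Fin k) :
    lam k L β b (c + 1) i = U c := by
  have hdet := rootMatrix_det_ne_zero hinj
  set v : Fin k → ℂ := fun r => (lsCount k L β r i : ℂ) with hv
  have h1 : (rootMatrix k b).mulVec U = v := by
    ext r
    rw [hv]
    simp only [hU, Matrix.mulVec, dotProduct, rootMatrix, Matrix.of_apply]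
    exact Finset.sum_congr rfl fun c _ => by rw [zpow_neg, zpow_natCast, inv_pow, mul_comm]
  have h2 : rootMatrixRepl k L β b (c + 1) i = (rootMatrix k b).updateCol c v := by
    ext r d
    simp only [rootMatrixRepl, rootMatrix, Matrix.of_apply, Matrix.updateCol_apply, hv,
      add_left_inj, Fin.ext_iff]
  rw [lam, h2, ← Matrix.cramer_apply, div_eq_iff hdet, ← h1, Matrix.cramer_eq_adjugate_mulVec,
    Matrix.mulVec_mulVec, Matrix.adjugate_mul, Matrix.smul_mulVec, Matrix.one_mulVec, Pi.smul_apply,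
    smul_eq_mul, mul_comm]

/-- The eigenvector identities at the `k` distinct roots form a Vandermonde system for `l_{n,1}, …,
l_{n,k}`. Its matrix does not depend on `n`, so a row of the inverse supplies the coefficients. -/
theorem IsParam.exists_coeff (h : IsParam k L β)
    (hroot : ∀ j ∈ Finset.Icc 1 k, ∑ i ∈ Finset.Icc 1 k, (L i : ℂ) * b j ^ i = 1)
    (hinj : Set.InjOn b (Finset.Icc 1 k)) {i : ℕ} (hi : i ∈ Finset.Icc 1 k) :
    ∃ U : Fin k → ℂ, ∀ n, (lsCount k L β n i : ℂ) = ∑ c, U c * (b (c + 1))⁻¹ ^ n := by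
  set A := Matrix.vandermonde fun c : Fin k => b (c + 1) with hA
  have hdet : IsUnit A.det := by
    rw [isUnit_iff_ne_zero, Matrix.det_vandermonde_ne_zero_iff]
    intro c d e
    have := hinj (by simp) (by simp) e
    ext; omega
  rw [Finset.mem_Icc] at hi
  let i' : Fin k := ⟨i - 1, by omega⟩
  refine ⟨A⁻¹ i', fun n => ?_⟩
  have h1 : A.mulVec (fun d : Fin k => (lsCount k L β n (d + 1) : ℂ))
      = fun c : Fin k => (b (c + 1))⁻¹ ^ n := by
    ext c
    rw [← h.sum_pow_mul_lsCount (hroot (c + 1) (by simp)) n, Finset.sum_range]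
    rfl
  have h2 := congrArg (fun v => A⁻¹.mulVec v i') h1
  simp only [Matrix.mulVec_mulVec, Matrix.nonsing_inv_mul A hdet, Matrix.one_mulVec] at h2
  rw [show i = (i' : ℕ) + 1 by simp [i']; omega, h2]
  rfl

/-- The explicit formula `l_{n,i} = ∑_j λ_{j,i} β_j^{-n}`, for all `n`. -/
theorem IsParam.lsCount_eq_sum_lam (h : IsParam k L β)
    (hroot : ∀ j ∈ Finset.Icc 1 k, ∑ i ∈ Finset.Icc 1 k, (L i : ℂ) * b j ^ i = 1)
    (hinj : Set.InjOn b (Finset.Icc 1 k)) {i : ℕ} (hi : i ≤ k) (n : ℕ) :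
    (lsCount k L β n i : ℂ) = ∑ j ∈ Finset.Icc 1 k, lam k L β b j i * (b j)⁻¹ ^ n := by
  have key : ∃ U : Fin k → ℂ, ∀ n, (lsCount k L β n i : ℂ) = ∑ c, U c * (b (c + 1))⁻¹ ^ n := by
    rcases Nat.eq_zero_or_pos i with rfl | hi0
    · choose! U hU using fun (i : ℕ) (hi : i ∈ Finset.Icc 1 k) => h.exists_coeff hroot hinj hi
      refine ⟨fun c => ∑ i ∈ Finset.Icc 1 k, U i c, fun n => ?_⟩
      rw [h.lsCount_total]
      push_cast
      simp only [Finset.sum_mul]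
      rw [Finset.sum_comm]
      exact Finset.sum_congr rfl fun i hi => hU i hi n
    · exact h.exists_coeff hroot hinj (by simp; omega)
  obtain ⟨U, hU⟩ := key
  rw [hU n]
  simp only [← lam_eq_of_forall hinj hU]
  rw [← Finset.sum_range (fun c => lam k L β b (c + 1) i * (b (c + 1))⁻¹ ^ n),
    Finset.range_eq_Ico, Finset.sum_Ico_add' (fun j => lam k L β b j i * (b j)⁻¹ ^ n) 0 k 1]
  exact Finset.sum_congr (by ext; simp) fun _ _ => rfl

/-- The explicit formula with the contribution of `β` split off. -/
theorem IsParam.lsCount_eq (h : IsParam k L β)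
    (hroot : ∀ j ∈ Finset.Icc 1 k, ∑ i ∈ Finset.Icc 1 k, (L i : ℂ) * b j ^ i = 1)
    (hinj : Set.InjOn b (Finset.Icc 1 k)) (hb1 : b 1 = (β : ℂ)) {i : ℕ} (hi : i ≤ k) (n : ℕ) :
    (lsCount k L β n i : ℂ) = lam k L β b 1 i * ((β⁻¹ ^ n : ℝ) : ℂ)
      + ∑ j ∈ Finset.Icc 2 k, lam k L β b j i * (b j)⁻¹ ^ n := by
  rw [h.lsCount_eq_sum_lam hroot hinj hi n, ← Finset.add_sum_Ioc_eq_sum_Icc h.one_le, hb1]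
  push_cast
  rfl

theorem isParam_of_roots {k : ℕ} {L : ℕ → ℕ} (hk : 1 ≤ k) (hL1 : L 1 ≠ 0)
    {β : ℝ} (hβ0 : 0 < β) (hβ1 : β < 1)
    (hroot : ∀ j ∈ Finset.Icc 1 k, ∑ i ∈ Finset.Icc 1 k, (L i : ℂ) * b j ^ i = 1)
    (hb1 : b 1 = (β : ℂ)) : IsParam k L β := by
  refine ⟨hk, hL1, hβ0, hβ1, ?_⟩
  have := hroot 1 (by simp; omega)
  rw [hb1] at this
  exact_mod_cast this

theorem sum_eq_one_of_roots (hb : (lsPoly k L).roots = (Finset.Icc 1 k).val.map b)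
    {j : ℕ} (hj : j ∈ Finset.Icc 1 k) : ∑ i ∈ Finset.Icc 1 k, (L i : ℂ) * b j ^ i = 1 := by
  have : b j ∈ (lsPoly k L).roots := by
    rw [hb]; exact Multiset.mem_map_of_mem _ hj
  have h2 := Polynomial.isRoot_of_mem_roots this
  rw [Polynomial.IsRoot, lsPoly, Polynomial.eval_sub, Polynomial.eval_finsetSum] at h2
  simp only [Polynomial.eval_mul, Polynomial.eval_C, Polynomial.eval_pow, Polynomial.eval_X,
    Polynomial.eval_one] at h2
  exact sub_eq_zero.1 h2

theorem injOn_of_roots (hb : (lsPoly k L).roots = (Finset.Icc 1 k).val.map b)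
    (hsimple : (lsPoly k L).roots.Nodup) : Set.InjOn b (Finset.Icc 1 k) := by
  rw [hb] at hsimple
  exact fun x hx y hy e => Multiset.inj_on_of_nodup_map hsimple x hx y hy e

end GenLS

namespace GenLS

variable {k : ℕ} {L : ℕ → ℕ} {β : ℝ}

/-! ### Classes of digits -/

/-- The partial sum `L_1 + … + L_i`, with `L_q` read as `0` for `q > k`. -/
def cumL (k : ℕ) (L : ℕ → ℕ) (i : ℕ) : ℕ := ∑ q ∈ Finset.Icc 1 i, coef k L q

/-- The class `r` of the digit `d`: it satisfies `L_1 + … + L_{r-1} ≤ d < L_1 + … + L_r`. -/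
noncomputable def digitClass (k : ℕ) (L : ℕ → ℕ) (d : ℕ) : ℕ := sInf {r | d < cumL k L r}

/-- The left endpoint of the `d`-th interval of the partition `ρ`. -/
noncomputable def offset (k : ℕ) (L : ℕ → ℕ) (β : ℝ) (d : ℕ) : ℝ :=
  ∑ c ∈ Finset.range d, β ^ digitClass k L c

theorem cumL_zero : cumL k L 0 = 0 := by simp [cumL]

theorem cumL_succ (i : ℕ) : cumL k L (i + 1) = cumL k L i + coef k L (i + 1) :=
  Finset.sum_Icc_succ_top (by omega) _

theorem cumL_mono : Monotone (cumL k L) :=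
  monotone_nat_of_le_succ fun i => by rw [cumL_succ]; omega

theorem cumL_eq_of_le {i : ℕ} (hi : k ≤ i) : cumL k L i = cumL k L k := by
  induction i, hi using Nat.le_induction with
  | base => rfl
  | succ i hi ih => rw [cumL_succ, ih, coef, if_neg (by omega), add_zero]

theorem cumL_le (i : ℕ) : cumL k L i ≤ cumL k L k := by
  rcases le_total i k with h | h
  · exact cumL_mono h
  · exact (cumL_eq_of_le h).le

theorem cumL_eq_sum {i : ℕ} (hi : i ≤ k) : cumL k L i = ∑ q ∈ Finset.Icc 1 i, L q :=
  Finset.sum_congr rfl fun q hq => by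
    rw [Finset.mem_Icc] at hq
    rw [coef, if_pos (by omega)]

theorem IsParam.cumL_pos (h : IsParam k L β) {i : ℕ} (hi : 1 ≤ i) : 0 < cumL k L i := by
  refine lt_of_lt_of_le ?_ (cumL_mono hi)
  have := h.one_le
  have := h.first_ne
  rw [cumL_succ, cumL_zero, coef, if_pos (by omega), zero_add, zero_add]
  omega

theorem lt_cumL_iff {d : ℕ} (hd : d < cumL k L k) (i : ℕ) :
    d < cumL k L i ↔ digitClass k L d ≤ i := by
  constructor
  · exact fun h => Nat.sInf_le h
  · intro h
    have : d < cumL k L (digitClass k L d) := Nat.sInf_mem (s := {r | d < cumL k L r}) ⟨k, hd⟩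
    exact lt_of_lt_of_le this (cumL_mono h)

theorem digitClass_le {d : ℕ} (hd : d < cumL k L k) : digitClass k L d ≤ k :=
  (lt_cumL_iff hd k).1 hd

theorem one_le_digitClass {d : ℕ} (hd : d < cumL k L k) : 1 ≤ digitClass k L d := by
  by_contra h
  have := (lt_cumL_iff hd 0).2 (by omega)
  rw [cumL_zero] at this
  omega

theorem IsParam.digitClass_zero (h : IsParam k L β) : digitClass k L 0 = 1 :=
  le_antisymm (Nat.sInf_le (h.cumL_pos le_rfl)) (one_le_digitClass (h.cumL_pos h.one_le))

theorem offset_zero : offset k L β 0 = 0 := by simp [offset]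

theorem offset_succ (d : ℕ) : offset k L β (d + 1) = offset k L β d + β ^ digitClass k L d :=
  Finset.sum_range_succ _ _

theorem IsParam.offset_strictMono (h : IsParam k L β) : StrictMono (offset k L β) :=
  strictMono_nat_of_lt_succ fun d => by
    rw [offset_succ]
    have := pow_pos h.pos (digitClass k L d)
    linarith

theorem digitPoint_zero (m : ℕ) : digitPoint k L β m 0 = 0 := by simp [digitPoint]

/-- The factor of `β ^ (m + r)` in `digitPoint` counts the digits of class `r` below the given one,
so raising the digit from `d` to `d + 1` changes only the term of the class of `d`. -/
theorem digitPoint_succ (m : ℕ) {d : ℕ} (hd : d < cumL k L k) :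
    digitPoint k L β m (d + 1) = digitPoint k L β m d + β ^ (m + digitClass k L d) := by
  have h1 := one_le_digitClass hd
  have h2 := digitClass_le hd
  have key : ∑ r ∈ Finset.Icc 1 k, β ^ (m + r) * (if r = digitClass k L d then (1 : ℝ) else 0)
      = β ^ (m + digitClass k L d) := by
    simp only [mul_ite, mul_one, mul_zero, Finset.sum_ite_eq', Finset.mem_Icc, h1, h2, and_self,
      if_true]
  rw [← key, digitPoint, digitPoint, ← Finset.sum_add_distrib]
  refine Finset.sum_congr rfl fun r hr => ?_
  rw [Finset.mem_Icc] at hr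
  rw [← mul_add, ← cumL_eq_sum hr.2, ← cumL_eq_sum (show r - 1 ≤ k by omega)]
  have hA := lt_cumL_iff hd (r - 1)
  have hB := lt_cumL_iff hd r
  have hAB := cumL_mono (k := k) (L := L) (show r - 1 ≤ r by omega)
  generalize cumL k L (r - 1) = A at *
  generalize cumL k L r = B at *
  -- Truncated differences are compared in additive form, so that the identity survives the cast to
  -- `ℝ`.
  have hnat : (d + 1 - A) + (d - B) = (d + 1 - B) + (d - A)
      + (if r = digitClass k L d then 1 else 0) := by
    split_ifs with hrd <;> omega
  have hreal : ((d + 1 - A : ℕ) : ℝ) + ((d - B : ℕ) : ℝ) = ((d + 1 - B : ℕ) : ℝ)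
      + ((d - A : ℕ) : ℝ) + (if r = digitClass k L d then (1 : ℝ) else 0) := by
    have := congrArg (Nat.cast (R := ℝ)) hnat
    push_cast at this ⊢
    exact_mod_cast this
  congr 1
  linarith

theorem digitPoint_eq (m : ℕ) {d : ℕ} (hd : d ≤ cumL k L k) :
    digitPoint k L β m d = β ^ m * offset k L β d := by
  induction d with
  | zero => rw [digitPoint_zero, offset_zero, mul_zero]
  | succ d ih => rw [digitPoint_succ m (by omega), ih (by omega), offset_succ, mul_add, pow_add]

theorem IsParam.offset_total (h : IsParam k L β) : offset k L β (cumL k L k) = 1 := by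
  have := digitPoint_eq (β := β) 0 (le_refl (cumL k L k))
  rw [pow_zero, one_mul] at this
  rw [← this, digitPoint, ← h.sum_eq]
  refine Finset.sum_congr rfl fun r hr => ?_
  rw [Finset.mem_Icc] at hr
  obtain ⟨r, rfl⟩ := Nat.exists_eq_add_of_le' hr.1
  rw [← cumL_eq_sum hr.2, ← cumL_eq_sum (show r + 1 - 1 ≤ k by omega), Nat.add_sub_cancel,
    Nat.cast_sub (cumL_mono (by omega)), Nat.cast_sub (cumL_mono hr.2), cumL_succ, coef,
    if_pos hr.2, zero_add]
  push_cast
  ring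

/-- If `ρ` had a single piece, its length `β` would be 1. -/
theorem IsParam.one_lt_total (h : IsParam k L β) : 1 < cumL k L k := by
  by_contra hc
  have h1 := h.cumL_pos h.one_le
  have h2 := h.offset_total
  rw [show cumL k L k = 0 + 1 by omega, offset_succ, offset_zero, h.digitClass_zero] at h2
  have := h.lt_one
  simp at h2
  linarith

theorem IsParam.offset_pos (h : IsParam k L β) {d : ℕ} (hd : 0 < d) : 0 < offset k L β d := by
  rw [← offset_zero (k := k) (L := L) (β := β)]
  exact h.offset_strictMono hd

theorem IsParam.offset_nonneg (h : IsParam k L β) (d : ℕ) : 0 ≤ offset k L β d := by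
  rw [← offset_zero (k := k) (L := L) (β := β)]
  exact h.offset_strictMono.monotone (Nat.zero_le d)

theorem IsParam.offset_le_one (h : IsParam k L β) {d : ℕ} (hd : d ≤ cumL k L k) :
    offset k L β d ≤ 1 := by
  rw [← h.offset_total]
  exact h.offset_strictMono.monotone hd

theorem IsParam.exists_digit (h : IsParam k L β) {u : ℝ} (hu0 : 0 ≤ u) (hu1 : u < 1) :
    ∃ d < cumL k L k, offset k L β d ≤ u ∧ u < offset k L β (d + 1) := by
  classical
  have hex : ∃ d, u < offset k L β d := ⟨_, by rw [h.offset_total]; exact hu1⟩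
  have hs := Nat.find_spec hex
  have hle : Nat.find hex ≤ cumL k L k := Nat.find_min' hex (by rw [h.offset_total]; exact hu1)
  have h0 : Nat.find hex ≠ 0 := fun e => by rw [e, offset_zero] at hs; linarith
  obtain ⟨d, hd⟩ := Nat.exists_eq_succ_of_ne_zero h0
  rw [hd] at hs
  exact ⟨d, by omega, not_lt.1 (Nat.find_min hex (by omega)), hs⟩

/-! ### Partial sums of the numbers `l_{m,i}` -/

/-- The number `l_{m,1} + … + l_{m,i}`. -/
noncomputable def cumCount (k : ℕ) (L : ℕ → ℕ) (β : ℝ) (m i : ℕ) : ℕ :=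
  ∑ q ∈ Finset.Icc 1 i, lsCount k L β m q

theorem cumCount_add_one (m i : ℕ) :
    cumCount k L β m (i + 1) = cumCount k L β m i + lsCount k L β m (i + 1) :=
  Finset.sum_Icc_succ_top (by omega) _

theorem cumCount_one (m : ℕ) : cumCount k L β m 1 = lsCount k L β m 1 := by simp [cumCount]

theorem cumCount_mono (m : ℕ) : Monotone (cumCount k L β m) :=
  monotone_nat_of_le_succ fun i => by rw [cumCount_add_one]; omega

theorem IsParam.cumCount_of_le (h : IsParam k L β) (m : ℕ) {i : ℕ} (hi : k ≤ i) :
    cumCount k L β m i = cumCount k L β m k := by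
  induction i, hi using Nat.le_induction with
  | base => rfl
  | succ i hi ih => rw [cumCount_add_one, ih, h.lsCount_of_lt _ _ (by omega), add_zero]

theorem IsParam.cumCount_le (h : IsParam k L β) (m i : ℕ) :
    cumCount k L β m i ≤ cumCount k L β m k := by
  rcases le_total i k with hi | hi
  · exact cumCount_mono m hi
  · exact (h.cumCount_of_le m hi).le

theorem IsParam.cumCount_zero (h : IsParam k L β) {i : ℕ} (hi : 1 ≤ i) :
    cumCount k L β 0 i = 1 := by
  induction i, hi using Nat.le_induction with
  | base => rw [cumCount_one, h.lsCount_zero 1 le_rfl, if_pos rfl]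
  | succ i hi ih =>
    rw [cumCount_add_one, ih, h.lsCount_zero _ (by omega), if_neg (by omega)]

theorem IsParam.cumCount_succ_add (h : IsParam k L β) (m i : ℕ) :
    cumCount k L β (m + 1) i + lsCount k L β m 1
      = cumCount k L β m (i + 1) + cumL k L i * lsCount k L β m 1 := by
  induction i with
  | zero => simp [cumCount, cumL]
  | succ i ih =>
    rw [cumCount_add_one, cumCount_add_one _ (i + 1), h.lsCount_succ _ _ (by omega), cumL_succ]
    linarith

/-- Block structure behind `enum`: the old left endpoints survive, the first piece of a cut interval
inheriting that of its parent. Each longest interval then adds one new endpoint for every further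
piece of class at most `i`. -/
theorem IsParam.cumCount_succ (h : IsParam k L β) (m : ℕ) {i : ℕ} (hi : 1 ≤ i) :
    cumCount k L β (m + 1) i
      = cumCount k L β m (i + 1) + (cumL k L i - 1) * lsCount k L β m 1 := by
  have h1 := h.cumCount_succ_add m i
  obtain ⟨c, hc⟩ := Nat.exists_eq_add_of_le' (h.cumL_pos hi)
  rw [hc] at h1 ⊢
  simp only [Nat.succ_eq_add_one, zero_add, Nat.add_sub_cancel] at h1 ⊢
  linarith

theorem IsParam.lsCount_total_succ (h : IsParam k L β) (m : ℕ) :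
    lsCount k L β m 0 < lsCount k L β (m + 1) 0 := by
  rw [h.lsCount_total, h.lsCount_total]
  have h1 := h.cumCount_succ m h.one_le
  rw [h.cumCount_of_le m (Nat.le_succ k)] at h1
  have h2 := Nat.mul_pos (Nat.sub_pos_of_lt h.one_lt_total) (h.lsCount_one_pos m)
  simp only [cumCount] at h1
  omega

theorem IsParam.lsCount_total_strictMono (h : IsParam k L β) :
    StrictMono fun m => lsCount k L β m 0 :=
  strictMono_nat_of_lt_succ h.lsCount_total_succ

theorem IsParam.lsCount_zero_total (h : IsParam k L β) : lsCount k L β 0 0 = 1 := by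
  rw [h.lsCount_total]
  exact h.cumCount_zero h.one_le

theorem IsParam.lt_lsCount_total (h : IsParam k L β) (m : ℕ) : m < lsCount k L β m 0 := by
  induction m with
  | zero => rw [h.lsCount_zero_total]; exact Nat.one_pos
  | succ m ih => have := h.lsCount_total_succ m; omega

/-! ### The points as a recursively defined enumeration -/

/-- The `x`-th (`x < l_{m,1} + … + l_{m,i}`) left endpoint of an interval of length at least
`β ^ (m + i - 1)` of the `m`-th partition, in the order of the numeration system. -/
noncomputable def enum (k : ℕ) (L : ℕ → ℕ) (β : ℝ) : ℕ → ℕ → ℕ → ℝ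
  | 0, _, _ => 0
  | m + 1, i, x =>
    if x < cumCount k L β m (i + 1) then enum k L β m (i + 1) x
    else enum k L β m 1 ((x - cumCount k L β m (i + 1)) % lsCount k L β m 1)
      + digitPoint k L β m (1 + (x - cumCount k L β m (i + 1)) / lsCount k L β m 1)

theorem enum_of_lt {m i x : ℕ} (hx : x < cumCount k L β m (i + 1)) :
    enum k L β (m + 1) i x = enum k L β m (i + 1) x := by
  rw [enum, if_pos hx]

theorem enum_of_le {m i x : ℕ} (hx : cumCount k L β m (i + 1) ≤ x) :
    enum k L β (m + 1) i x =
      enum k L β m 1 ((x - cumCount k L β m (i + 1)) % lsCount k L β m 1)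
      + digitPoint k L β m (1 + (x - cumCount k L β m (i + 1)) / lsCount k L β m 1) := by
  rw [enum, if_neg (by omega)]

theorem enum_add {m i q x : ℕ} (hx : x < lsCount k L β m 1) :
    enum k L β (m + 1) i (cumCount k L β m (i + 1) + (q * lsCount k L β m 1 + x))
      = enum k L β m 1 x + digitPoint k L β m (q + 1) := by
  rw [enum_of_le (by omega), Nat.add_sub_cancel_left, add_comm (q * _), Nat.add_mul_mod_self_right,
    Nat.mod_eq_of_lt hx, Nat.add_mul_div_right _ _ (by omega), Nat.div_eq_of_lt hx, zero_add,
    add_comm 1]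

theorem IsParam.enum_index (h : IsParam k L β) {m i x : ℕ} (hi : k ≤ i) :
    enum k L β m i x = enum k L β m k x := by
  induction m generalizing i with
  | zero => rfl
  | succ m ih =>
    rw [enum, enum, h.cumCount_of_le m (show k ≤ i + 1 by omega),
      h.cumCount_of_le m (show k ≤ k + 1 by omega), ih (show k ≤ i + 1 by omega),
      ih (show k ≤ k + 1 by omega)]

/-- Passing to a finer partition only appends points, so the enumerations with `i = k` are initial
segments of one infinite sequence. -/
theorem IsParam.enum_level (h : IsParam k L β) {m n x : ℕ} (hmn : m ≤ n)
    (hx : x < lsCount k L β m 0) : enum k L β n k x = enum k L β m k x := by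
  induction n, hmn using Nat.le_induction with
  | base => rfl
  | succ n hn ih =>
    rw [enum_of_lt, h.enum_index (Nat.le_succ k), ih]
    rw [h.cumCount_of_le n (Nat.le_succ k), cumCount, ← h.lsCount_total]
    exact lt_of_lt_of_le hx (h.lsCount_total_strictMono.monotone hn)

theorem IsParam.topIndex_le (h : IsParam k L β) {N : ℕ} (hN : 1 ≤ N) :
    lsCount k L β (topIndex (lsCount k L β) N) 0 ≤ N :=
  Nat.findGreatest_spec (P := fun m => lsCount k L β m 0 ≤ N) (Nat.zero_le N) (by
    rw [h.lsCount_zero_total]; exact hN)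

theorem IsParam.lt_topIndex (h : IsParam k L β) (N : ℕ) :
    N < lsCount k L β (topIndex (lsCount k L β) N + 1) 0 := by
  by_contra hc
  have h1 := h.lt_lsCount_total (topIndex (lsCount k L β) N + 1)
  have h2 := Nat.le_findGreatest (P := fun m => lsCount k L β m 0 ≤ N)
    (show topIndex (lsCount k L β) N + 1 ≤ N by omega) (by omega)
  change topIndex (lsCount k L β) N + 1 ≤ topIndex (lsCount k L β) N at h2
  omega

/-- The remainder which the digit algorithm passes on to the next lower index. -/
def DigitState.next (l : ℕ → ℕ → ℕ) (m : ℕ) (s : DigitState) : ℕ :=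
  s.rem - s.eps * s.T - s.eta * l m 1

/-- The digit algorithm is the recursion of `enum`. A zero digit is its first branch, which raises
the index `i` by one; a nonzero digit is its second branch, which resets `i` to 1. Hence `i = zeros
+ 1`, and `T_m` is the threshold between the branches. -/
theorem IsParam.enum_stateDown (h : IsParam k L β) {N n : ℕ} (hN : lsCount k L β n 0 ≤ N) {d : ℕ}
    (hd : d ≤ n) :
    enum k L β (n + 1) k N =
      enum k L β (n - d) ((stateDown (lsCount k L β) N n d).zeros + 1)
          ((stateDown (lsCount k L β) N n d).next (lsCount k L β) (n - d))
        + ∑ e ∈ Finset.range (d + 1), digitPoint k L β (n - e)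
            ((stateDown (lsCount k L β) N n e).eps + (stateDown (lsCount k L β) N n e).eta) := by
  induction d with
  | zero =>
    have hc : cumCount k L β n (k + 1) = lsCount k L β n 0 := by
      rw [h.cumCount_of_le n (Nat.le_succ k), cumCount, ← h.lsCount_total]
    rw [enum_of_le (by rw [hc]; exact hN), hc]
    simp only [stateDown, topState, DigitState.next, Nat.sub_zero, one_mul, zero_add,
      Finset.sum_range_one]
    rw [Nat.mod_eq_sub_div_mul]
  | succ d ih =>
    rw [ih (by omega), Finset.sum_range_succ _ (d + 1), ← add_assoc]
    obtain ⟨m, hm⟩ : ∃ m, n - d = m + 1 := ⟨n - (d + 1), by omega⟩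
    have hm' : n - (d + 1) = m := by omega
    rw [hm, hm', add_right_comm]
    congr 1
    simp only [stateDown, hm']
    generalize stateDown (lsCount k L β) N n d = s
    by_cases hlt : s.next (lsCount k L β) (m + 1) < cumCount k L β m (s.zeros + 1 + 1)
    · have e : nextState (lsCount k L β) m s
          = ⟨s.next (lsCount k L β) (m + 1), cumCount k L β m (s.zeros + 2), 0, 0, s.zeros + 1⟩ :=
        if_pos hlt
      rw [enum_of_lt hlt, e]
      simp [DigitState.next, digitPoint_zero]
    · have e : nextState (lsCount k L β) m s
          = ⟨s.next (lsCount k L β) (m + 1), cumCount k L β m (s.zeros + 2), 1,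
              (s.next (lsCount k L β) (m + 1) - cumCount k L β m (s.zeros + 2))
                / lsCount k L β m 1, 0⟩ := if_neg hlt
      rw [enum_of_le (not_lt.1 hlt), e]
      simp only [DigitState.next, one_mul, zero_add]
      rw [Nat.mod_eq_sub_div_mul]

theorem IsParam.lsPoint_eq_enum (h : IsParam k L β) {N M : ℕ} (hN : 1 ≤ N)
    (hM : N < lsCount k L β M 0) : lsPoint k L β N = enum k L β M k N := by
  have h1 := h.topIndex_le hN
  have h2 := h.lt_topIndex N
  rw [lsPoint]
  simp only [digitState]
  generalize topIndex (lsCount k L β) N = n at *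
  have hnM : n < M := h.lsCount_total_strictMono.lt_iff_lt.1 (lt_of_le_of_lt h1 hM)
  rw [h.enum_level hnM h2, h.enum_stateDown h1 le_rfl, Nat.sub_self, enum, zero_add,
    ← Finset.sum_range_reflect]
  refine Finset.sum_congr rfl fun e he => ?_
  rw [Finset.mem_range] at he
  rw [show n + 1 - 1 - e = n - e by omega, show n - (n - e) = e by omega]

end GenLS

namespace GenLS

variable {k : ℕ} {L : ℕ → ℕ} {β : ℝ}

/-! ### Elementary intervals -/

/-- `Cell k L β m c e` says that `[e, e + β ^ (m + c))` is an interval of the `m`-th partition. -/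
inductive Cell (k : ℕ) (L : ℕ → ℕ) (β : ℝ) : ℕ → ℕ → ℝ → Prop
  | root : Cell k L β 0 0 0
  | keep {m c : ℕ} {e : ℝ} (h : Cell k L β m (c + 1) e) : Cell k L β (m + 1) c e
  | cut {m c d : ℕ} {e f : ℝ} (h : Cell k L β m 0 e) (hd : d < cumL k L k)
      (hc : c + 1 = digitClass k L d) (hf : f = e + β ^ m * offset k L β d) :
      Cell k L β (m + 1) c f

theorem IsParam.offset_add_le (h : IsParam k L β) {d : ℕ} (hd : d < cumL k L k) :
    offset k L β d + β ^ digitClass k L d ≤ 1 := by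
  rw [← offset_succ]
  exact h.offset_le_one hd

/-- The subinterval with number `d` of a longest interval. -/
theorem IsParam.child_subset (h : IsParam k L β) (m : ℕ) (e : ℝ) {d : ℕ} (hd : d < cumL k L k) :
    Set.Ico (e + β ^ m * offset k L β d)
        (e + β ^ m * offset k L β d + β ^ (m + digitClass k L d)) ⊆ Set.Ico e (e + β ^ m) := by
  have h1 := mul_nonneg (pow_pos h.pos m).le (h.offset_nonneg d)
  have h2 := mul_le_mul_of_nonneg_left (h.offset_add_le hd) (pow_pos h.pos m).le
  rw [mul_add, mul_one, ← pow_add] at h2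
  exact Set.Ico_subset_Ico (by linarith) (by linarith)

theorem IsParam.child_disjoint (h : IsParam k L β) {m : ℕ} {e y : ℝ} {d d' : ℕ}
    (hy : y ∈ Set.Ico (e + β ^ m * offset k L β d)
        (e + β ^ m * offset k L β d + β ^ (m + digitClass k L d)))
    (hy' : y ∈ Set.Ico (e + β ^ m * offset k L β d')
        (e + β ^ m * offset k L β d' + β ^ (m + digitClass k L d'))) : d = d' := by
  have key : ∀ a b : ℕ, e + β ^ m * offset k L β b ≤ y →
      y < e + β ^ m * offset k L β a + β ^ (m + digitClass k L a) → b ≤ a := by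
    intro a b h1 h2
    by_contra hab
    have h3 := h.offset_strictMono.monotone (show a + 1 ≤ b by omega)
    rw [offset_succ] at h3
    have h4 := mul_le_mul_of_nonneg_left h3 (pow_pos h.pos m).le
    rw [mul_add, ← pow_add] at h4
    linarith
  exact le_antisymm (key _ _ hy.1 hy'.2) (key _ _ hy'.1 hy.2)

theorem IsParam.cell_parent (h : IsParam k L β) {m c : ℕ} {e : ℝ} (hc : Cell k L β (m + 1) c e) :
    ∃ c' e', Cell k L β m c' e' ∧
      Set.Ico e (e + β ^ (m + 1 + c)) ⊆ Set.Ico e' (e' + β ^ (m + c')) := by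
  cases hc with
  | keep hk => exact ⟨_, _, hk, by rw [show m + 1 + c = m + (c + 1) by ring]⟩
  | @cut _ _ d e' _ hk hd hcl hf =>
    refine ⟨_, _, hk, ?_⟩
    rw [hf, show m + 1 + c = m + (c + 1) by ring, hcl]
    exact h.child_subset m e' hd

theorem IsParam.left_mem (h : IsParam k L β) (e : ℝ) (m : ℕ) : e ∈ Set.Ico e (e + β ^ m) :=
  ⟨le_rfl, by have := pow_pos h.pos m; linarith⟩

/-- Different intervals of a partition are disjoint. -/
theorem IsParam.cell_unique (h : IsParam k L β) {m c c' : ℕ} {e e' y : ℝ} (hc : Cell k L β m c e)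
    (hc' : Cell k L β m c' e') (hy : y ∈ Set.Ico e (e + β ^ (m + c)))
    (hy' : y ∈ Set.Ico e' (e' + β ^ (m + c'))) : c = c' ∧ e = e' := by
  induction m generalizing c c' e e' with
  | zero => cases hc; cases hc'; exact ⟨rfl, rfl⟩
  | succ m ih =>
    cases hc with
    | keep hk =>
      rw [show m + 1 + c = m + (c + 1) by ring] at hy
      cases hc' with
      | keep hk' =>
        rw [show m + 1 + c' = m + (c' + 1) by ring] at hy'
        obtain ⟨h1, h2⟩ := ih hk hk' hy hy'
        exact ⟨by omega, h2⟩
      | cut hk' hd' hcl' hf' =>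
        rw [hf', show m + 1 + c' = m + (c' + 1) by ring, hcl'] at hy'
        exact absurd (ih hk hk' hy (h.child_subset _ _ hd' hy')).1 (by omega)
    | cut hk hd hcl hf =>
      rw [hf, show m + 1 + c = m + (c + 1) by ring, hcl] at hy
      have hy2 := h.child_subset _ _ hd hy
      cases hc' with
      | keep hk' =>
        rw [show m + 1 + c' = m + (c' + 1) by ring] at hy'
        exact absurd (ih hk hk' hy2 hy').1 (by omega)
      | cut hk' hd' hcl' hf' =>
        rw [hf', show m + 1 + c' = m + (c' + 1) by ring, hcl'] at hy'
        obtain ⟨-, rfl⟩ := ih hk hk' hy2 (h.child_subset _ _ hd' hy')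
        obtain rfl := h.child_disjoint hy hy'
        exact ⟨by omega, by rw [hf, hf']⟩

theorem IsParam.cell_ancestor (h : IsParam k L β) {m n c : ℕ} {e : ℝ} (hmn : m ≤ n)
    (hc : Cell k L β n c e) : ∃ c' e', Cell k L β m c' e' ∧
      Set.Ico e (e + β ^ (n + c)) ⊆ Set.Ico e' (e' + β ^ (m + c')) := by
  induction n, hmn using Nat.le_induction generalizing c e with
  | base => exact ⟨c, e, hc, subset_rfl⟩
  | succ n hn ih =>
    obtain ⟨c', e', h1, h2⟩ := h.cell_parent hc
    obtain ⟨c'', e'', h3, h4⟩ := ih h1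
    exact ⟨c'', e'', h3, h2.trans h4⟩

/-- Intervals of a finer partition do not straddle those of a coarser one. -/
theorem IsParam.cell_nested (h : IsParam k L β) {r n c c₀ : ℕ} {e e₀ y y' : ℝ} (hrn : r ≤ n)
    (hc : Cell k L β n c e) (h₀ : Cell k L β r c₀ e₀) (hy : y ∈ Set.Ico e (e + β ^ (n + c)))
    (hy' : y' ∈ Set.Ico e (e + β ^ (n + c))) (hy₀ : y ∈ Set.Ico e₀ (e₀ + β ^ (r + c₀))) :
    y' ∈ Set.Ico e₀ (e₀ + β ^ (r + c₀)) := by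
  obtain ⟨c', e', h1, h2⟩ := h.cell_ancestor hrn hc
  obtain ⟨rfl, rfl⟩ := h.cell_unique h1 h₀ (h2 hy) hy₀
  exact h2 hy'

theorem Cell.keep_add {m c j : ℕ} {e : ℝ} (hc : Cell k L β m (c + j) e) :
    Cell k L β (m + j) c e := by
  induction j generalizing c with
  | zero => exact hc
  | succ j ih => exact .keep (ih (by rwa [add_assoc, add_comm 1 j]))

/-- A piece of class `r` waits uncut for `r - 1` further steps, until it is among the longest
intervals of partition `m + r`. -/
theorem Cell.child {m d : ℕ} {e : ℝ} (hc : Cell k L β m 0 e) (hd : d < cumL k L k) :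
    Cell k L β (m + digitClass k L d) 0 (e + β ^ m * offset k L β d) := by
  have h1 := one_le_digitClass hd
  have h2 : Cell k L β (m + 1) (0 + (digitClass k L d - 1)) (e + β ^ m * offset k L β d) :=
    .cut hc hd (by omega) rfl
  have h3 := h2.keep_add
  rwa [show m + 1 + (digitClass k L d - 1) = m + digitClass k L d by omega] at h3

/-! ### The enumeration runs through the left endpoints -/

theorem IsParam.digit_lt (h : IsParam k L β) {m i x : ℕ} (hi : 1 ≤ i)
    (hx : x < cumCount k L β (m + 1) i) (hle : cumCount k L β m (i + 1) ≤ x) :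
    1 + (x - cumCount k L β m (i + 1)) / lsCount k L β m 1 < cumL k L i := by
  have h1 := h.cumL_pos hi
  have : (x - cumCount k L β m (i + 1)) / lsCount k L β m 1 < cumL k L i - 1 := by
    rw [Nat.div_lt_iff_lt_mul (h.lsCount_one_pos m)]
    have := h.cumCount_succ m hi
    omega
  omega

theorem IsParam.cell_enum (h : IsParam k L β) {m i x : ℕ} (hi : 1 ≤ i)
    (hx : x < cumCount k L β m i) : ∃ c < i, Cell k L β m c (enum k L β m i x) := by
  induction m generalizing i x with
  | zero => exact ⟨0, hi, .root⟩
  | succ m ih =>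
    rcases lt_or_ge x (cumCount k L β m (i + 1)) with hlt | hle
    · rw [enum_of_lt hlt]
      obtain ⟨c, hc, hcell⟩ := ih (by omega) hlt
      cases c with
      | zero =>
        refine ⟨0, by omega, .cut hcell (h.cumL_pos h.one_le) ?_ ?_⟩
        · rw [h.digitClass_zero]
        · rw [offset_zero, mul_zero, add_zero]
      | succ c => exact ⟨c, by omega, .keep hcell⟩
    · rw [enum_of_le hle]
      have hd := h.digit_lt hi hx hle
      have hdk := lt_of_lt_of_le hd (cumL_le i)
      obtain ⟨c, hc, hcell⟩ := ih le_rfl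
        (by rw [cumCount_one]; exact Nat.mod_lt (x - cumCount k L β m (i + 1)) (h.lsCount_one_pos m))
      obtain rfl : c = 0 := by omega
      have h1 := one_le_digitClass hdk
      have h2 := (lt_cumL_iff hdk i).1 hd
      exact ⟨_, by omega, .cut hcell hdk (Nat.sub_add_cancel h1) (by rw [digitPoint_eq m hdk.le])⟩

theorem IsParam.enum_surj (h : IsParam k L β) {m i c : ℕ} {e : ℝ} (hc : Cell k L β m c e)
    (hci : c < i) : ∃ x < cumCount k L β m i, enum k L β m i x = e := by
  induction m generalizing i c e with
  | zero => cases hc; exact ⟨0, by rw [h.cumCount_zero (by omega)]; omega, rfl⟩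
  | succ m ih =>
    have hS := h.cumCount_succ m (show 1 ≤ i by omega)
    cases hc with
    | keep hk =>
      obtain ⟨x, hx, he⟩ := ih hk (show c + 1 < i + 1 by omega)
      exact ⟨x, by omega, by rw [enum_of_lt hx, he]⟩
    | @cut _ _ d e' _ hk hd hcl hf =>
      rcases Nat.eq_zero_or_pos d with rfl | hd0
      · obtain ⟨x, hx, he⟩ := ih hk (show 0 < i + 1 by omega)
        exact ⟨x, by omega, by rw [enum_of_lt hx, he, hf, offset_zero, mul_zero, add_zero]⟩
      · obtain ⟨x, hx, he⟩ := ih hk Nat.one_pos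
        rw [cumCount_one] at hx
        obtain ⟨q, rfl⟩ := Nat.exists_eq_add_of_le' hd0
        refine ⟨cumCount k L β m (i + 1) + (q * lsCount k L β m 1 + x), ?_, ?_⟩
        · have h1 := (lt_cumL_iff hd i).2 (by omega)
          have h2 : (q + 1) * lsCount k L β m 1 ≤ (cumL k L i - 1) * lsCount k L β m 1 :=
            Nat.mul_le_mul_right _ (by omega)
          rw [add_mul, one_mul] at h2
          omega
        · rw [enum_add hx, he, digitPoint_eq m hd.le, hf]

theorem IsParam.enum_inj (h : IsParam k L β) {m i x x' : ℕ} (hi : 1 ≤ i)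
    (hx : x < cumCount k L β m i) (hx' : x' < cumCount k L β m i)
    (e : enum k L β m i x = enum k L β m i x') : x = x' := by
  induction m generalizing i x x' with
  | zero => rw [h.cumCount_zero hi] at hx hx'; omega
  | succ m ih =>
    have hpos := h.lsCount_one_pos m
    have hmod : ∀ z, z % lsCount k L β m 1 < cumCount k L β m 1 := fun z => by
      rw [cumCount_one]; exact Nat.mod_lt _ hpos
    have hcell : ∀ z, Cell k L β m 0 (enum k L β m 1 (z % lsCount k L β m 1)) := fun z => by
      obtain ⟨c, hc, hcell⟩ := h.cell_enum le_rfl (hmod z)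
      obtain rfl : c = 0 := by omega
      exact hcell
    have hmem : ∀ (u : ℝ) {d : ℕ}, d < cumL k L k →
        u + digitPoint k L β m d ∈ Set.Ico u (u + β ^ (m + 0)) := fun u d hd => by
      rw [digitPoint_eq m hd.le]
      exact h.child_subset m u hd (h.left_mem _ _)
    -- An old point is the left endpoint of a cell, whereas an appended point lies in a longest cell
    -- at positive distance from its left endpoint. Disjointness of cells makes a coincidence
    -- impossible.
    have mixed : ∀ {x x' : ℕ}, x < cumCount k L β m (i + 1) → cumCount k L β m (i + 1) ≤ x' →
        x' < cumCount k L β (m + 1) i → enum k L β (m + 1) i x = enum k L β (m + 1) i x' →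
        False := by
      intro x x' hlt hle hx' e
      have hd := lt_of_lt_of_le (h.digit_lt hi hx' hle) (cumL_le i)
      rw [enum_of_lt hlt, enum_of_le hle] at e
      obtain ⟨c, -, hc⟩ := h.cell_enum (by omega) hlt
      have h1 := hmem (enum k L β m 1 ((x' - cumCount k L β m (i + 1)) % lsCount k L β m 1)) hd
      rw [← e] at h1
      obtain ⟨-, h2⟩ := h.cell_unique hc (hcell _) (h.left_mem _ _) h1
      rw [digitPoint_eq m hd.le, ← h2] at e
      have h3 := mul_pos (pow_pos h.pos m) (h.offset_pos (Nat.add_pos_left Nat.one_pos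
        ((x' - cumCount k L β m (i + 1)) / lsCount k L β m 1)))
      linarith
    rcases lt_or_ge x (cumCount k L β m (i + 1)) with hlt | hle
    · rcases lt_or_ge x' (cumCount k L β m (i + 1)) with hlt' | hle'
      · rw [enum_of_lt hlt, enum_of_lt hlt'] at e
        exact ih (by omega) hlt hlt' e
      · exact (mixed hlt hle' hx' e).elim
    · rcases lt_or_ge x' (cumCount k L β m (i + 1)) with hlt' | hle'
      · exact (mixed hlt' hle hx e.symm).elim
      · have hd := lt_of_lt_of_le (h.digit_lt hi hx hle) (cumL_le i)
        have hd' := lt_of_lt_of_le (h.digit_lt hi hx' hle') (cumL_le i)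
        rw [enum_of_le hle, enum_of_le hle'] at e
        obtain ⟨-, h2⟩ := h.cell_unique (hcell _) (hcell _) (hmem _ hd) (e ▸ hmem _ hd')
        have h3 := ih le_rfl (hmod _) (hmod _) h2
        rw [h2, digitPoint_eq m hd.le, digitPoint_eq m hd'.le] at e
        have h4 := h.offset_strictMono.injective
          (mul_left_cancel₀ (pow_pos h.pos m).ne' (add_left_cancel e))
        have h5 := Nat.div_add_mod (x - cumCount k L β m (i + 1)) (lsCount k L β m 1)
        have h6 := Nat.div_add_mod (x' - cumCount k L β m (i + 1)) (lsCount k L β m 1)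
        rw [show (x - cumCount k L β m (i + 1)) / lsCount k L β m 1
          = (x' - cumCount k L β m (i + 1)) / lsCount k L β m 1 by omega, h3, h6] at h5
        omega

/-! ### Counting points in elementary intervals -/

/-- The number of the first `X` points of an enumeration which lie in `[u, v)`. -/
noncomputable def hits (k : ℕ) (L : ℕ → ℕ) (β : ℝ) (m i X : ℕ) (u v : ℝ) : ℕ := by
  classical exact ∑ x ∈ Finset.range X, if enum k L β m i x ∈ Set.Ico u v then 1 else 0

/-- The points are distinct left endpoints of cells, and a cell contains no left endpoint but its
own. -/
theorem IsParam.hits_le_one (h : IsParam k L β) {m i X c : ℕ} {e u v : ℝ} (hi : 1 ≤ i)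
    (hX : X ≤ cumCount k L β m i) (hc : Cell k L β m c e)
    (huv : Set.Ico u v ⊆ Set.Ico e (e + β ^ (m + c))) : hits k L β m i X u v ≤ 1 := by
  classical
  rw [hits, ← Finset.card_filter, Finset.card_le_one]
  intro x hx y hy
  simp only [Finset.mem_filter, Finset.mem_range] at hx hy
  have key : ∀ z < X, enum k L β m i z ∈ Set.Ico u v → enum k L β m i z = e := by
    intro z hz hzm
    obtain ⟨c', -, hc'⟩ := h.cell_enum hi (lt_of_lt_of_le hz hX)
    exact (h.cell_unique hc' hc (h.left_mem _ _) (huv hzm)).2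
  exact h.enum_inj hi (lt_of_lt_of_le hx.1 hX) (lt_of_lt_of_le hy.1 hX)
    ((key x hx.1 hx.2).trans (key y hy.1 hy.2).symm)

theorem IsParam.hits_full_base (h : IsParam k L β) {m i : ℕ} {e : ℝ} (hi : 1 ≤ i)
    (hc : Cell k L β m 0 e) : hits k L β m i (cumCount k L β m i) e (e + β ^ m) = 1 := by
  classical
  refine le_antisymm (h.hits_le_one hi le_rfl hc subset_rfl) ?_
  obtain ⟨x, hx, he⟩ := h.enum_surj hc (show 0 < i by omega)
  rw [hits, ← Finset.card_filter, Nat.succ_le_iff, Finset.card_pos]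
  exact ⟨x, by simp only [Finset.mem_filter, Finset.mem_range]; exact ⟨hx, he ▸ h.left_mem _ _⟩⟩

theorem hits_of_le {m i X : ℕ} {u v : ℝ} (hX : X ≤ cumCount k L β m (i + 1)) :
    hits k L β (m + 1) i X u v = hits k L β m (i + 1) X u v := by
  classical
  refine Finset.sum_congr rfl fun x hx => ?_
  rw [enum_of_lt (lt_of_lt_of_le (Finset.mem_range.1 hx) hX)]

/-- The translation stays inside one longest interval of partition `m`, and that interval does not
straddle the coarser one. Thus every translated block has the same number of hits. -/
theorem IsParam.mem_iff_of_shift (h : IsParam k L β) {r m x d : ℕ} {e : ℝ} (hrm : r ≤ m)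
    (hc : Cell k L β r 0 e) (hx : x < lsCount k L β m 1) (hd : d < cumL k L k) :
    enum k L β m 1 x + digitPoint k L β m d ∈ Set.Ico e (e + β ^ r)
      ↔ enum k L β m 1 x ∈ Set.Ico e (e + β ^ r) := by
  obtain ⟨c, hc1, hcell⟩ := h.cell_enum le_rfl (by rw [cumCount_one]; exact hx)
  obtain rfl : c = 0 := by omega
  have h1 := h.left_mem (enum k L β m 1 x) (m + 0)
  have h2 : enum k L β m 1 x + digitPoint k L β m d
      ∈ Set.Ico (enum k L β m 1 x) (enum k L β m 1 x + β ^ (m + 0)) := by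
    rw [digitPoint_eq m hd.le]
    exact h.child_subset m _ hd (h.left_mem _ _)
  exact ⟨fun h3 => h.cell_nested hrm hcell hc h2 h1 h3, fun h3 => h.cell_nested hrm hcell hc h1 h2 h3⟩

/-- Full blocks carry the digits `1, …, q`, and the partial block carries `q + 1`. That last digit
need be admissible only when `X ≠ 0`, which leaves room for the largest `q` in `IsParam.hits_full`.
-/
theorem IsParam.hits_add (h : IsParam k L β) {r m i q X : ℕ} {e : ℝ} (hrm : r ≤ m)
    (hc : Cell k L β r 0 e) (hX : X ≤ lsCount k L β m 1) (hq : X ≠ 0 → q + 1 < cumL k L k)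
    (hq' : q < cumL k L k) :
    hits k L β (m + 1) i (cumCount k L β m (i + 1) + (q * lsCount k L β m 1 + X)) e (e + β ^ r)
      = hits k L β m (i + 1) (cumCount k L β m (i + 1)) e (e + β ^ r)
        + (q * hits k L β m 1 (lsCount k L β m 1) e (e + β ^ r)
          + hits k L β m 1 X e (e + β ^ r)) := by
  classical
  have hblock : ∀ q Y, Y ≤ lsCount k L β m 1 → (Y ≠ 0 → q + 1 < cumL k L k) →
      ∑ x ∈ Finset.range Y, (if enum k L β (m + 1) i (cumCount k L β m (i + 1)
        + (q * lsCount k L β m 1 + x)) ∈ Set.Ico e (e + β ^ r) then 1 else 0)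
        = hits k L β m 1 Y e (e + β ^ r) := by
    intro q Y hY hqY
    refine Finset.sum_congr rfl fun x hx => ?_
    rw [Finset.mem_range] at hx
    rw [enum_add (by omega)]
    simp only [h.mem_iff_of_shift hrm hc (show x < _ by omega) (hqY (by omega))]
  have hsum : ∀ q < cumL k L k, ∑ x ∈ Finset.range (q * lsCount k L β m 1),
      (if enum k L β (m + 1) i (cumCount k L β m (i + 1) + x) ∈ Set.Ico e (e + β ^ r)
        then 1 else 0) = q * hits k L β m 1 (lsCount k L β m 1) e (e + β ^ r) := by
    intro q hq
    induction q with
    | zero => simp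
    | succ q ih =>
      rw [add_mul, one_mul, Finset.sum_range_add, ih (by omega), hblock q _ le_rfl fun _ => hq]
      ring
  rw [hits, Finset.sum_range_add, Finset.sum_range_add, hsum q hq', hblock q X hX hq]
  congr 1
  exact hits_of_le le_rfl

/-- Self-similarity: as a function of `j`, the number of hits obeys the recursion of `cumCount` and
starts from the same value 1. -/
theorem IsParam.hits_full (h : IsParam k L β) {r i : ℕ} {e : ℝ} (j : ℕ) (hi : 1 ≤ i)
    (hc : Cell k L β r 0 e) :
    hits k L β (r + j) i (cumCount k L β (r + j) i) e (e + β ^ r) = cumCount k L β j i := by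
  induction j generalizing i with
  | zero => rw [add_zero, h.hits_full_base hi hc, h.cumCount_zero hi]
  | succ j ih =>
    have h1 := h.hits_add (i := i) (q := cumL k L i - 1) (X := 0) (show r ≤ r + j by omega) hc
      (Nat.zero_le _) (fun h0 => absurd rfl h0) (by
        have := h.cumL_pos hi
        have := cumL_le (k := k) (L := L) i
        omega)
    have h2 := ih (i := 1) le_rfl
    rw [cumCount_one, cumCount_one] at h2
    have h3 : hits k L β (r + j) 1 0 e (e + β ^ r) = 0 := by simp [hits]
    rw [add_zero, ← h.cumCount_succ _ hi, ih (by omega), h2, h3, add_zero,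
      ← h.cumCount_succ _ hi] at h1
    exact h1

end GenLS

namespace GenLS

variable {k : ℕ} {L : ℕ → ℕ} {β : ℝ} {b : ℕ → ℂ}

/-! ### The error in an elementary interval -/

/-- The deviation of a full block of the enumeration in an elementary interval. -/
noncomputable def blockError (k : ℕ) (L : ℕ → ℕ) (β : ℝ) (r j i : ℕ) : ℝ :=
  (cumCount k L β j i : ℝ) - β ^ r * cumCount k L β (r + j) i

/-- The intervals of the `m`-th partition have total length 1, and none is longer than `β ^ m`. -/
theorem IsParam.one_le_lsCount_mul (h : IsParam k L β) (m : ℕ) :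
    1 ≤ (lsCount k L β m 0 : ℝ) * β ^ m := by
  have hx : ∑ i ∈ Finset.Icc 1 k, (L i : ℂ) * (β : ℂ) ^ i = 1 := by exact_mod_cast h.sum_eq
  have h1 := h.sum_pow_mul_lsCount hx m
  have h2 : ∑ i ∈ Finset.range k, β ^ i * (lsCount k L β m (i + 1) : ℝ) = β⁻¹ ^ m := by
    exact_mod_cast h1
  have h3 : β⁻¹ ^ m ≤ lsCount k L β m 0 := by
    rw [← h2, h.lsCount_total]
    push_cast
    have e := Finset.sum_Ico_add' (fun i => (lsCount k L β m i : ℝ)) 0 k 1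
    rw [show Finset.Icc 1 k = Finset.Ico (0 + 1) (k + 1) by ext; simp, ← e,
      ← Finset.range_eq_Ico]
    refine Finset.sum_le_sum fun i _ => mul_le_of_le_one_left (Nat.cast_nonneg _) ?_
    exact pow_le_one₀ h.pos.le h.lt_one.le
  calc (1 : ℝ) = β⁻¹ ^ m * β ^ m := by rw [← mul_pow, inv_mul_cancel₀ h.pos.ne', one_pow]
    _ ≤ _ := mul_le_mul_of_nonneg_right h3 (pow_pos h.pos m).le

theorem IsParam.hits_error_succ (h : IsParam k L β) {r i q X : ℕ} {e : ℝ} (j : ℕ) (hi : 1 ≤ i)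
    (hc : Cell k L β r 0 e) (hX : X ≤ lsCount k L β (r + j) 1) (hq : q + 1 < cumL k L k) :
    (hits k L β (r + (j + 1)) i
        (cumCount k L β (r + j) (i + 1) + (q * lsCount k L β (r + j) 1 + X)) e (e + β ^ r) : ℝ)
        - (cumCount k L β (r + j) (i + 1) + (q * lsCount k L β (r + j) 1 + X) : ℕ) * β ^ r
      = blockError k L β r j (i + 1) + q * blockError k L β r j 1
        + (hits k L β (r + j) 1 X e (e + β ^ r) - X * β ^ r) := by
  have h1 := h.hits_add (i := i) (q := q) (show r ≤ r + j by omega) hc hX (fun _ => hq) (by omega)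
  have h2 := h.hits_full j le_rfl hc
  rw [cumCount_one] at h2
  rw [← add_assoc, h1, h.hits_full j (by omega) hc, h2, blockError, blockError, cumCount_one (r + j)]
  push_cast
  ring

/-- Descent by one level: either all `X` points are old, and `i` becomes `i + 1`, or they consist of
the old block, `q` full translates and a partial translate, which is the same problem with `i = 1`.
Each level therefore costs at most one `ε j`. -/
theorem IsParam.hits_error (h : IsParam k L β) {r : ℕ} {e : ℝ} (hc : Cell k L β r 0 e)
    {ε : ℕ → ℝ} (hε : ∀ j i, 2 ≤ i → |blockError k L β r j i|
      + ((cumL k L k : ℝ) - 2) * |blockError k L β r j 1| ≤ ε j)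
    (j : ℕ) {i X : ℕ} (hi : 1 ≤ i) (hX : X ≤ cumCount k L β (r + j) i) :
    |(hits k L β (r + j) i X e (e + β ^ r) : ℝ) - X * β ^ r|
      ≤ lsCount k L β r 0 * β ^ r + ∑ j' ∈ Finset.range j, ε j' := by
  have htot : (2 : ℝ) ≤ cumL k L k := by exact_mod_cast h.one_lt_total
  induction j generalizing i X with
  | zero =>
    have h1 : (hits k L β (r + 0) i X e (e + β ^ r) : ℝ) ≤ 1 := by
      exact_mod_cast h.hits_le_one hi hX hc subset_rfl
    have h2 : (X : ℝ) ≤ lsCount k L β r 0 := by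
      rw [h.lsCount_total]
      exact_mod_cast hX.trans (h.cumCount_le r i)
    have h3 := mul_le_mul_of_nonneg_right h2 (pow_pos h.pos r).le
    have h4 := h.one_le_lsCount_mul r
    have h5 : (0 : ℝ) ≤ hits k L β (r + 0) i X e (e + β ^ r) := Nat.cast_nonneg _
    have h6 : (0 : ℝ) ≤ X * β ^ r := mul_nonneg (Nat.cast_nonneg _) (pow_pos h.pos r).le
    rw [Finset.sum_range_zero, abs_le]
    constructor <;> linarith
  | succ j ih =>
    rw [Finset.sum_range_succ]
    have hεj := hε j (i + 1) (by omega)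
    have hnn := mul_nonneg (sub_nonneg.2 htot) (abs_nonneg (blockError k L β r j 1))
    rcases le_or_gt X (cumCount k L β (r + j) (i + 1)) with hle | hlt
    · have h1 := ih (show 1 ≤ i + 1 by omega) hle
      rw [← add_assoc, hits_of_le hle]
      have := abs_nonneg (blockError k L β r j (i + 1))
      linarith
    · have hpos := h.lsCount_one_pos (r + j)
      set l := lsCount k L β (r + j) 1 with hl
      -- Subtracting 1 before dividing makes the last block nonempty, possibly full. This yields `q
      -- ≤ L_1 + … + L_k - 2`, the coefficient appearing in `Λ_j`.
      set q := (X - cumCount k L β (r + j) (i + 1) - 1) / l with hq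
      have hS := h.cumCount_succ (r + j) hi
      rw [← hl] at hS
      have hqlt : q < cumL k L i - 1 := by
        rw [hq, Nat.div_lt_iff_lt_mul hpos]
        rw [← add_assoc] at hX
        omega
      have hqk : q + 1 < cumL k L k := (Nat.add_lt_of_lt_sub hqlt).trans_le (cumL_le i)
      have hdm := Nat.div_add_mod' (X - cumCount k L β (r + j) (i + 1) - 1) l
      have hml := Nat.mod_lt (X - cumCount k L β (r + j) (i + 1) - 1) hpos
      rw [← hq] at hdm
      obtain ⟨Y, hY⟩ : ∃ Y, X = cumCount k L β (r + j) (i + 1) + (q * l + Y) :=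
        ⟨(X - cumCount k L β (r + j) (i + 1) - 1) % l + 1, by omega⟩
      have hYl : Y ≤ l := by omega
      have h1 := ih (i := 1) le_rfl (X := Y) (by rw [cumCount_one]; exact hYl)
      have h2 := h.hits_error_succ j hi hc hYl hqk
      rw [← hl, ← hY] at h2
      rw [h2]
      have h3 : (q : ℝ) ≤ (cumL k L k : ℝ) - 2 := by
        have : ((q + 2 : ℕ) : ℝ) ≤ cumL k L k := by exact_mod_cast hqk
        push_cast at this
        linarith
      have h4 := mul_le_mul_of_nonneg_right h3 (abs_nonneg (blockError k L β r j 1))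
      calc _ ≤ |blockError k L β r j (i + 1)| + |(q : ℝ) * blockError k L β r j 1|
            + |(hits k L β (r + j) 1 Y e (e + β ^ r) : ℝ) - Y * β ^ r| :=
            (abs_add_le _ _).trans (add_le_add_left (abs_add_le _ _) _)
        _ ≤ _ := by
            rw [abs_mul, Nat.abs_cast]
            linarith

/-! ### Error bounds from the roots outside the unit disc -/

/-- `b 1 = β, b 2, …, b k` are distinct roots of `∑ L_i X ^ i = 1`, and those besides `β` lie outside
the closed unit disc. -/
structure IsRoots (k : ℕ) (L : ℕ → ℕ) (β : ℝ) (b : ℕ → ℂ) : Prop where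
  root : ∀ j ∈ Finset.Icc 1 k, ∑ i ∈ Finset.Icc 1 k, (L i : ℂ) * b j ^ i = 1
  inj : Set.InjOn b (Finset.Icc 1 k)
  first : b 1 = (β : ℂ)
  one_lt : ∀ j ∈ Finset.Icc 2 k, 1 < ‖b j‖

theorem IsRoots.inv_lt_one (hr : IsRoots k L β b) {p : ℕ} (hp : p ∈ Finset.Icc 2 k) :
    ‖b p‖⁻¹ < 1 := inv_lt_one_of_one_lt₀ (hr.one_lt p hp)

/-- The contributions of `β` cancel, since `β ^ r * β⁻¹ ^ (r + j) = β⁻¹ ^ j`. Each other root `b p`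
keeps the factor `1 - β ^ r * (b p)⁻¹ ^ r`, of modulus at most 2. -/
theorem IsRoots.abs_lsCount_sub_le (hr : IsRoots k L β b) (h : IsParam k L β) (r j : ℕ) {q : ℕ}
    (hq : q ≤ k) :
    |(lsCount k L β j q : ℝ) - β ^ r * lsCount k L β (r + j) q|
      ≤ ∑ p ∈ Finset.Icc 2 k, 2 * ‖lam k L β b p q‖ * ‖b p‖⁻¹ ^ j := by
  have h1 := h.lsCount_eq hr.root hr.inj hr.first hq j
  have h2 := h.lsCount_eq hr.root hr.inj hr.first hq (r + j)
  have h3 : ((β ^ r : ℝ) : ℂ) * ((β⁻¹ ^ (r + j) : ℝ) : ℂ) = ((β⁻¹ ^ j : ℝ) : ℂ) := by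
    rw [← Complex.ofReal_mul]
    congr 1
    rw [pow_add, ← mul_assoc, ← mul_pow, mul_inv_cancel₀ h.pos.ne', one_pow, one_mul]
  have h4 : (((lsCount k L β j q : ℝ) - β ^ r * lsCount k L β (r + j) q : ℝ) : ℂ)
      = ∑ p ∈ Finset.Icc 2 k, lam k L β b p q * ((b p)⁻¹ ^ j * (1 - (β ^ r : ℝ) * (b p)⁻¹ ^ r)) := by
    push_cast at h3 ⊢
    rw [h1, h2]
    push_cast
    rw [mul_add, mul_left_comm, h3, add_sub_add_left_eq_sub, Finset.mul_sum,
      ← Finset.sum_sub_distrib]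
    refine Finset.sum_congr rfl fun p _ => ?_
    rw [pow_add]
    ring
  rw [← Real.norm_eq_abs, ← Complex.norm_real, h4]
  refine (norm_sum_le _ _).trans (Finset.sum_le_sum fun p hp => ?_)
  have h5 : ‖1 - ((β ^ r : ℝ) : ℂ) * (b p)⁻¹ ^ r‖ ≤ 2 := by
    refine (norm_sub_le _ _).trans ?_
    rw [norm_one, norm_mul, Complex.norm_real, Real.norm_eq_abs, abs_of_pos (pow_pos h.pos r),
      norm_pow, norm_inv]
    have := mul_le_one₀ (pow_le_one₀ h.pos.le h.lt_one.le (n := r))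
      (pow_nonneg (inv_nonneg.2 (norm_nonneg (b p))) r)
      (pow_le_one₀ (inv_nonneg.2 (norm_nonneg (b p))) (hr.inv_lt_one hp).le (n := r))
    linarith
  rw [norm_mul, norm_mul, norm_pow, norm_inv]
  have h6 := mul_le_mul_of_nonneg_left h5 (mul_nonneg (norm_nonneg (lam k L β b p q))
    (pow_nonneg (inv_nonneg.2 (norm_nonneg (b p))) j))
  calc _ = _ := (mul_assoc _ _ _).symm
    _ ≤ _ := h6
    _ = _ := by ring

theorem IsRoots.abs_blockError_le (hr : IsRoots k L β b) (h : IsParam k L β) (r j i : ℕ) :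
    |blockError k L β r j i| ≤ ∑ p ∈ Finset.Icc 2 k,
      2 * (∑ q ∈ Finset.Icc 1 (min i k), ‖lam k L β b p q‖) * ‖b p‖⁻¹ ^ j := by
  have e : ∀ m, cumCount k L β m i = cumCount k L β m (min i k) := fun m => by
    rcases le_total i k with hi | hi
    · rw [min_eq_left hi]
    · rw [min_eq_right hi, h.cumCount_of_le m hi]
  have e2 : blockError k L β r j i = ∑ q ∈ Finset.Icc 1 (min i k),
      ((lsCount k L β j q : ℝ) - β ^ r * lsCount k L β (r + j) q) := by
    rw [blockError, e, e, cumCount, cumCount, Finset.sum_sub_distrib, ← Finset.mul_sum]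
    push_cast
    rfl
  rw [e2]
  refine (Finset.abs_sum_le_sum_abs _ _).trans ?_
  simp only [Finset.mul_sum, Finset.sum_mul]
  rw [Finset.sum_comm]
  refine Finset.sum_le_sum fun q hq => ?_
  rw [Finset.mem_Icc] at hq
  exact hr.abs_lsCount_sub_le h r j (hq.2.trans (min_le_right i k))

theorem IsRoots.bigLam_ge (hr : IsRoots k L β b) {p i : ℕ} (hp : p ∈ Finset.Icc 2 k) (hi : 2 ≤ i) :
    (∑ q ∈ Finset.Icc 1 (min i k), ‖lam k L β b p q‖)
        + ((cumL k L k : ℝ) - 2) * ‖lam k L β b p 1‖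
      ≤ bigLam k L β b p * (1 - ‖b p‖⁻¹) := by
  have h1 : 0 < 1 - ‖b p‖⁻¹ := sub_pos.2 (hr.inv_lt_one hp)
  rw [← div_le_iff₀ h1, cumL_eq_sum le_rfl]
  push_cast
  have hk : 2 ≤ k := (Finset.mem_Icc.1 hp).1.trans (Finset.mem_Icc.1 hp).2
  exact le_ciSup (f := fun ℓ : Finset.Icc 2 k =>
    ((∑ i ∈ Finset.Icc 1 (ℓ : ℕ), ‖lam k L β b p i‖)
        + ((∑ i ∈ Finset.Icc 1 k, (L i : ℝ)) - 2) * ‖lam k L β b p 1‖) / (1 - ‖b p‖⁻¹))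
    (Set.finite_range _).bddAbove ⟨min i k, Finset.mem_Icc.2 ⟨le_min hi hk, min_le_right i k⟩⟩

theorem IsRoots.bigLam_nonneg (hr : IsRoots k L β b) (h : IsParam k L β) {p : ℕ}
    (hp : p ∈ Finset.Icc 2 k) : 0 ≤ bigLam k L β b p := by
  have h1 := hr.bigLam_ge hp le_rfl
  have h2 : (2 : ℝ) ≤ cumL k L k := by exact_mod_cast h.one_lt_total
  have h3 : 0 ≤ bigLam k L β b p * (1 - ‖b p‖⁻¹) := le_trans (add_nonneg
    (Finset.sum_nonneg fun _ _ => norm_nonneg _)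
    (mul_nonneg (by linarith) (norm_nonneg _))) h1
  exact nonneg_of_mul_nonneg_left h3 (sub_pos.2 (hr.inv_lt_one hp))

theorem IsRoots.lsCount_mul_le (hr : IsRoots k L β b) (h : IsParam k L β) (r : ℕ) :
    lsCount k L β r 0 * β ^ r
      ≤ ‖lam k L β b 1 0‖ + ∑ p ∈ Finset.Icc 2 k, ‖lam k L β b p 0‖ := by
  have h1 := h.lsCount_eq hr.root hr.inj hr.first (Nat.zero_le k) r
  have h2 : (lsCount k L β r 0 : ℝ) * β ^ r = ‖(lsCount k L β r 0 : ℂ) * ((β ^ r : ℝ) : ℂ)‖ := by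
    rw [norm_mul, Complex.norm_natCast, Complex.norm_real, Real.norm_eq_abs,
      abs_of_pos (pow_pos h.pos r)]
  have h3 : ((β⁻¹ ^ r : ℝ) : ℂ) * ((β ^ r : ℝ) : ℂ) = 1 := by
    rw [← Complex.ofReal_mul, ← mul_pow, inv_mul_cancel₀ h.pos.ne', one_pow, Complex.ofReal_one]
  rw [h2, h1, add_mul, mul_assoc, h3, mul_one, Finset.sum_mul]
  refine (norm_add_le _ _).trans (add_le_add_right ((norm_sum_le _ _).trans
    (Finset.sum_le_sum fun p hp => ?_)) _)
  rw [norm_mul, norm_mul, norm_pow, norm_inv, Complex.norm_real, Real.norm_eq_abs,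
    abs_of_pos (pow_pos h.pos r), mul_assoc]
  exact mul_le_of_le_one_right (norm_nonneg _) (mul_le_one₀
    (pow_le_one₀ (inv_nonneg.2 (norm_nonneg _)) (hr.inv_lt_one hp).le) (pow_pos h.pos r).le
    (pow_le_one₀ h.pos.le h.lt_one.le))

theorem IsRoots.lsCount_mul_le_bigR (hr : IsRoots k L β b) (h : IsParam k L β) (r : ℕ) :
    lsCount k L β r 0 * β ^ r ≤ bigR k L β b - 1 := by
  refine (hr.lsCount_mul_le h r).trans ?_
  have h1 : ∑ p ∈ Finset.Icc 2 k, ‖lam k L β b p 0‖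
      ≤ ∑ p ∈ Finset.Icc 2 k, (2 * bigLam k L β b p + ‖lam k L β b p 0‖) :=
    Finset.sum_le_sum fun p hp => by have := hr.bigLam_nonneg h hp; linarith
  rw [bigR]
  linarith

theorem geom_sum_mul_le {θ : ℝ} (h0 : 0 ≤ θ) (n : ℕ) :
    (1 - θ) * ∑ j ∈ Finset.range n, θ ^ j ≤ 1 := by
  rw [mul_neg_geom_sum]
  have := pow_nonneg h0 n
  linarith

/-- The error in an elementary interval of length `β ^ r` is bounded. -/
theorem IsRoots.hits_error_le (hr : IsRoots k L β b) (h : IsParam k L β) {r M X : ℕ} {e : ℝ}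
    (hrM : r ≤ M) (hc : Cell k L β r 0 e) (hX : X ≤ lsCount k L β M 0) :
    |(hits k L β M k X e (e + β ^ r) : ℝ) - X * β ^ r| ≤ bigR k L β b - 1 := by
  obtain ⟨j, rfl⟩ := Nat.exists_eq_add_of_le hrM
  have hX' : X ≤ cumCount k L β (r + j) k := by rwa [cumCount, ← h.lsCount_total]
  have htot : (2 : ℝ) ≤ cumL k L k := by exact_mod_cast h.one_lt_total
  -- The factor `1 - ‖b p‖⁻¹` cancels the denominator in `Λ_p`; summed over all levels, the
  -- geometric series then costs at most `2 Λ_p` for each root.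
  have h1 := h.hits_error hc (ε := fun j => ∑ p ∈ Finset.Icc 2 k,
    2 * (bigLam k L β b p * (1 - ‖b p‖⁻¹)) * ‖b p‖⁻¹ ^ j) (by
      intro j i hi
      have h2 := hr.abs_blockError_le h r j i
      have h3 := mul_le_mul_of_nonneg_left (hr.abs_blockError_le h r j 1) (sub_nonneg.2 htot)
      rw [min_eq_left h.one_le] at h3
      simp only [Finset.Icc_self, Finset.sum_singleton] at h3
      refine (add_le_add h2 h3).trans ?_
      rw [Finset.mul_sum, ← Finset.sum_add_distrib]
      refine Finset.sum_le_sum fun p hp => ?_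
      have h4 := mul_le_mul_of_nonneg_right (hr.bigLam_ge hp hi)
        (pow_nonneg (inv_nonneg.2 (norm_nonneg (b p))) j)
      nlinarith [h4]) j h.one_le hX'
  refine h1.trans ?_
  have h5 := hr.lsCount_mul_le h r
  have h6 : ∑ j' ∈ Finset.range j, ∑ p ∈ Finset.Icc 2 k,
      2 * (bigLam k L β b p * (1 - ‖b p‖⁻¹)) * ‖b p‖⁻¹ ^ j'
      ≤ ∑ p ∈ Finset.Icc 2 k, 2 * bigLam k L β b p := by
    rw [Finset.sum_comm]
    refine Finset.sum_le_sum fun p hp => ?_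
    rw [← Finset.mul_sum]
    have h7 := mul_le_mul_of_nonneg_left
      (geom_sum_mul_le (inv_nonneg.2 (norm_nonneg (b p))) j) (hr.bigLam_nonneg h hp)
    linarith
  rw [bigR, Finset.sum_add_distrib]
  linarith

end GenLS

namespace GenLS
open Filter Topology

variable {k : ℕ} {L : ℕ → ℕ} {β : ℝ} {b : ℕ → ℂ}

/-! ### The error in arbitrary intervals -/

/-- The error of the first `X` points in `[u, v)`. -/
noncomputable def countError (k : ℕ) (L : ℕ → ℕ) (β : ℝ) (M X : ℕ) (u v : ℝ) : ℝ :=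
  hits k L β M k X u v - X * (v - u)

theorem hits_eq_add {m i X : ℕ} {u v w : ℝ} (huv : u ≤ v) (hvw : v ≤ w) :
    hits k L β m i X u w = hits k L β m i X u v + hits k L β m i X v w := by
  classical
  rw [hits, hits, hits, ← Finset.sum_add_distrib]
  refine Finset.sum_congr rfl fun x _ => ?_
  simp only [Set.mem_Ico]
  rcases lt_or_ge (enum k L β m i x) v with h1 | h1
  · simp [h1, h1.trans_le hvw, not_le.2 h1]
  · simp [h1, not_lt.2 h1, huv.trans h1]

theorem countError_eq_add {M X : ℕ} {u v w : ℝ} (huv : u ≤ v) (hvw : v ≤ w) :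
    countError k L β M X u w = countError k L β M X u v + countError k L β M X v w := by
  rw [countError, hits_eq_add huv hvw, countError, countError]
  push_cast
  ring

theorem countError_self {M X : ℕ} (u : ℝ) : countError k L β M X u u = 0 := by
  simp [countError, hits]

/-- The number of elementary intervals which the theorem allots to a level. -/
noncomputable def levelFactor (k : ℕ) (L : ℕ → ℕ) : ℝ :=
  2 * (L 1 : ℝ) + (∑ i ∈ Finset.Icc 2 k, (L i : ℝ)) - 2

theorem IsParam.total_eq (h : IsParam k L β) :
    (cumL k L k : ℝ) = L 1 + ∑ i ∈ Finset.Icc 2 k, (L i : ℝ) := by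
  rw [cumL_eq_sum le_rfl, ← Finset.add_sum_Ioc_eq_sum_Icc h.one_le]
  push_cast
  rfl

theorem IsParam.total_le_levelFactor (h : IsParam k L β) :
    (cumL k L k : ℝ) - 1 ≤ levelFactor k L := by
  have h1 : (1 : ℝ) ≤ L 1 := by exact_mod_cast Nat.one_le_iff_ne_zero.2 h.first_ne
  rw [h.total_eq, levelFactor]
  linarith

theorem IsParam.one_le_levelFactor (h : IsParam k L β) : 1 ≤ levelFactor k L := by
  have h1 : (2 : ℝ) ≤ cumL k L k := by exact_mod_cast h.one_lt_total
  have h2 := h.total_le_levelFactor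
  linarith

/-- Amortized cost: splitting off `d` whole pieces before entering piece `d` advances by the class
of `d` many levels. In class 1, `d ≤ L_1 - 1` is at most half of `levelFactor`; from class 2 on, the
bound `L_1 + … + L_k - 1` is spread over at least two levels. -/
theorem IsParam.digit_le (h : IsParam k L β) {d : ℕ} (hd : d < cumL k L k) :
    (d : ℝ) ≤ digitClass k L d * (levelFactor k L / 2) := by
  have h1 := one_le_digitClass hd
  rcases h1.eq_or_lt with h2 | h2
  · have h3 := (lt_cumL_iff hd 1).2 h2.ge
    rw [cumL_eq_sum h.one_le, Finset.Icc_self, Finset.sum_singleton] at h3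
    have h4 : (d : ℝ) + 1 ≤ L 1 := by exact_mod_cast h3
    have h5 : (0 : ℝ) ≤ ∑ i ∈ Finset.Icc 2 k, (L i : ℝ) :=
      Finset.sum_nonneg fun _ _ => Nat.cast_nonneg _
    rw [← h2, levelFactor]
    push_cast
    linarith
  · have h3 : (d : ℝ) + 1 ≤ cumL k L k := by exact_mod_cast hd
    have h4 : (2 : ℝ) ≤ digitClass k L d := by exact_mod_cast h2
    have h5 := h.total_le_levelFactor
    have h6 := h.one_le_levelFactor
    have h7 := mul_le_mul_of_nonneg_right h4 (show 0 ≤ levelFactor k L / 2 by linarith)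
    linarith

/-- Inside one cell of partition `M` there is at most one point, and the expected number is at most
`t_M β ^ M`; no cancellation is needed. -/
theorem IsRoots.countError_deep (hr : IsRoots k L β b) (h : IsParam k L β) {M X c : ℕ}
    {e u v : ℝ} (hX : X ≤ lsCount k L β M 0) (hc : Cell k L β M c e) (huv : u ≤ v)
    (hsub : Set.Ico u v ⊆ Set.Ico e (e + β ^ (M + c))) :
    |countError k L β M X u v| ≤ bigR k L β b - 1 := by
  have h0 := hr.lsCount_mul_le_bigR h M
  have h1 := h.one_le_lsCount_mul M
  have h2 : (X : ℝ) ≤ lsCount k L β M 0 := by exact_mod_cast hX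
  have h3 : (hits k L β M k X u v : ℝ) ≤ 1 := by
    exact_mod_cast h.hits_le_one h.one_le (by rwa [cumCount, ← h.lsCount_total]) hc hsub
  have h4 : (0 : ℝ) ≤ hits k L β M k X u v := Nat.cast_nonneg _
  have h5 : v - u ≤ β ^ M := by
    rcases huv.eq_or_lt with rfl | hlt
    · rw [sub_self]; exact (pow_pos h.pos M).le
    · have h6 := (Set.Ico_subset_Ico_iff hlt).1 hsub
      have h7 : β ^ (M + c) ≤ β ^ M :=
        pow_le_pow_of_le_one h.pos.le h.lt_one.le (Nat.le_add_right M c)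
      linarith [h6.1, h6.2]
  have h8 : (X : ℝ) * (v - u) ≤ lsCount k L β M 0 * β ^ M :=
    mul_le_mul h2 h5 (sub_nonneg.2 huv) (Nat.cast_nonneg _)
  have h9 : 0 ≤ (X : ℝ) * (v - u) := mul_nonneg (Nat.cast_nonneg _) (sub_nonneg.2 huv)
  rw [countError, abs_le]
  constructor <;> linarith

theorem IsRoots.countError_cell (hr : IsRoots k L β b) (h : IsParam k L β) {M X r : ℕ}
    {e : ℝ} (hX : X ≤ lsCount k L β M 0) (hc : Cell k L β r 0 e) :
    |countError k L β M X e (e + β ^ r)| ≤ bigR k L β b - 1 := by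
  rcases le_total r M with hrM | hrM
  · have := hr.hits_error_le h hrM hc hX
    rwa [countError, add_sub_cancel_left]
  · obtain ⟨c, e', h1, h2⟩ := h.cell_ancestor hrM hc
    exact hr.countError_deep h hX h1 (by have := pow_pos h.pos r; linarith) h2

theorem IsRoots.countError_children (hr : IsRoots k L β b) (h : IsParam k L β) {M X r d : ℕ}
    {e : ℝ} (hX : X ≤ lsCount k L β M 0) (hc : Cell k L β r 0 e) (hd : d ≤ cumL k L k) :
    |countError k L β M X e (e + β ^ r * offset k L β d)| ≤ d * (bigR k L β b - 1) := by
  induction d with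
  | zero => simp [offset_zero, countError_self]
  | succ d ih =>
    have h1 := hr.countError_cell h hX (hc.child (show d < cumL k L k by omega))
    have h2 : e + β ^ r * offset k L β (d + 1)
        = e + β ^ r * offset k L β d + β ^ (r + digitClass k L d) := by
      rw [offset_succ, mul_add, pow_add, add_assoc]
    have h3 := mul_nonneg (pow_pos h.pos r).le (h.offset_nonneg d)
    have h4 := pow_pos h.pos (r + digitClass k L d)
    rw [h2, countError_eq_add (v := e + β ^ r * offset k L β d) (by linarith) (by linarith)]
    refine (abs_add_le _ _).trans ((add_le_add (ih (by omega)) h1).trans ?_)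
    push_cast
    linarith

/-- Descend through the longest intervals containing `y`, splitting off the whole pieces to the left
of `y`, and stop at level `M` or beyond. The last cut starts at a level at most `M - 1` and advances
by at most `k`, so no level beyond `M + k - 1` is reached; `s` counts the levels that remain. -/
theorem IsRoots.countError_initial (hr : IsRoots k L β b) (h : IsParam k L β) {M X : ℕ}
    (hX : X ≤ lsCount k L β M 0) (s : ℕ) {r : ℕ} {e y : ℝ} (hs : r + s + 1 = M + k)
    (hc : Cell k L β r 0 e) (hy : y ∈ Set.Ico e (e + β ^ r)) :
    |countError k L β M X e y|
      ≤ s * (levelFactor k L / 2 * (bigR k L β b - 1)) + (bigR k L β b - 1) := by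
  have hR : 0 ≤ bigR k L β b - 1 := by
    have := hr.lsCount_mul_le_bigR h 0
    have := h.one_le_lsCount_mul 0
    linarith
  have hK := h.one_le_levelFactor
  induction s using Nat.strong_induction_on generalizing r e with
  | _ s ih =>
  rcases le_or_gt M r with hMr | hrM
  · obtain ⟨c, e', h1, h2⟩ := h.cell_ancestor hMr hc
    have h3 := hr.countError_deep h hX h1 hy.1
      ((Set.Ico_subset_Ico_right hy.2.le).trans h2)
    have : 0 ≤ (s : ℝ) * (levelFactor k L / 2 * (bigR k L β b - 1)) :=
      mul_nonneg (Nat.cast_nonneg _) (mul_nonneg (by linarith) hR)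
    linarith
  · have hpos := pow_pos h.pos r
    obtain ⟨d, hd, h1, h2⟩ := h.exists_digit (u := (y - e) / β ^ r)
      (div_nonneg (sub_nonneg.2 hy.1) hpos.le)
      ((div_lt_one hpos).2 (by linarith [hy.2]))
    rw [le_div_iff₀ hpos] at h1
    rw [div_lt_iff₀ hpos, offset_succ, add_mul, mul_comm _ (β ^ r), mul_comm _ (β ^ r),
      ← pow_add] at h2
    have hcl := one_le_digitClass hd
    have hclk := digitClass_le hd
    have h3 := ih (s - digitClass k L d) (by omega)
      (show r + digitClass k L d + (s - digitClass k L d) + 1 = M + k by omega) (hc.child hd)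
      ⟨by linarith, by linarith⟩
    have h4 := hr.countError_children h hX hc hd.le
    have h5 := mul_le_mul_of_nonneg_right (h.digit_le hd) hR
    have h6 := mul_nonneg hpos.le (h.offset_nonneg d)
    rw [Nat.cast_sub (by omega), sub_mul] at h3
    rw [countError_eq_add (v := e + β ^ r * offset k L β d) (by linarith) (by linarith)]
    refine (abs_add_le _ _).trans ((add_le_add h4 h3).trans ?_)
    linarith

theorem IsRoots.countError_le (hr : IsRoots k L β b) (h : IsParam k L β) {n X : ℕ}
    (hX : X ≤ lsCount k L β (n + 1) 0) {u v : ℝ} (hu : 0 ≤ u) (huv : u < v) (hv : v ≤ 1) :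
    |countError k L β (n + 1) X u v|
      ≤ (n + k) * (levelFactor k L * (bigR k L β b - 1)) + 2 * (bigR k L β b - 1) := by
  have hR : 0 ≤ bigR k L β b - 1 := by
    have := hr.lsCount_mul_le_bigR h 0
    have := h.one_le_lsCount_mul 0
    linarith
  have hK := h.one_le_levelFactor
  have hinit : ∀ y : ℝ, 0 ≤ y → y ≤ 1 → |countError k L β (n + 1) X 0 y|
      ≤ ((n + k : ℕ) : ℝ) * (levelFactor k L / 2 * (bigR k L β b - 1)) + (bigR k L β b - 1) := by
    intro y hy0 hy1
    rcases hy1.lt_or_eq with hlt | rfl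
    · exact hr.countError_initial h hX (n + k) (by omega) .root (by simpa using ⟨hy0, hlt⟩)
    · have h1 := hr.countError_cell h hX .root
      rw [pow_zero, zero_add] at h1
      have : 0 ≤ ((n + k : ℕ) : ℝ) * (levelFactor k L / 2 * (bigR k L β b - 1)) :=
        mul_nonneg (Nat.cast_nonneg _) (mul_nonneg (by linarith) hR)
      linarith
  have h1 := hinit u hu (by linarith)
  have h2 := hinit v (by linarith) hv
  have h3 := countError_eq_add (k := k) (L := L) (β := β) (M := n + 1) (X := X) hu huv.le
  rw [show countError k L β (n + 1) X u v
    = countError k L β (n + 1) X 0 v - countError k L β (n + 1) X 0 u by linarith]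
  refine (abs_sub _ _).trans ((add_le_add h2 h1).trans ?_)
  push_cast
  linarith

/-! ### Discrepancy -/

theorem IsRoots.mul_discrepancy_le (hr : IsRoots k L β b) (h : IsParam k L β) {N n : ℕ}
    (hN : 1 ≤ N) (hn : N < lsCount k L β (n + 1) 0) :
    discrepancy (lsPoint k L β) N ≤ ((n + k) * (levelFactor k L * (bigR k L β b - 1))
      + (2 * (bigR k L β b - 1) + 1)) / N := by
  classical
  have hR : 0 ≤ bigR k L β b - 1 := by
    have := hr.lsCount_mul_le_bigR h 0
    have := h.one_le_lsCount_mul 0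
    linarith
  have hK := h.one_le_levelFactor
  have hN0 : (0 : ℝ) < N := by exact_mod_cast hN
  refine Real.sSup_le ?_ (by positivity)
  rintro _ ⟨u, v, hu, huv, hv, rfl⟩
  -- The enumeration starts with a point of index 0, which is not in the sequence. Hence `N + 1`
  -- points are counted; dropping that point together with its expected share `v - u` changes the
  -- error by at most 1.
  have h1 : (hits k L β (n + 1) k (N + 1) u v : ℝ)
      = (if enum k L β (n + 1) k 0 ∈ Set.Ico u v then 1 else 0)
        + ∑ x ∈ Finset.Icc 1 N, (Set.Ico u v).indicator (fun _ => (1 : ℝ)) (lsPoint k L β x) := by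
    rw [hits, Finset.sum_range_succ', add_comm]
    push_cast
    congr 1
    have e := Finset.sum_Ico_add' (fun x => (Set.Ico u v).indicator (fun _ => (1 : ℝ))
      (lsPoint k L β x)) 0 N 1
    rw [show Finset.Icc 1 N = Finset.Ico (0 + 1) (N + 1) by ext; simp, ← e,
      ← Finset.range_eq_Ico]
    refine Finset.sum_congr rfl fun x hx => ?_
    rw [Finset.mem_range] at hx
    rw [Set.indicator_apply, h.lsPoint_eq_enum (M := n + 1) (by omega) (by omega)]
  have h2 := hr.countError_le h (show N + 1 ≤ lsCount k L β (n + 1) 0 by omega) hu huv hv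
  rw [countError, h1] at h2
  generalize ∑ x ∈ Finset.Icc 1 N, (Set.Ico u v).indicator (fun _ => (1 : ℝ)) (lsPoint k L β x)
    = A at h2 ⊢
  have h3 : 1 / (N : ℝ) * A - (v - u) = (A - N * (v - u)) / N := by field_simp
  rw [h3, abs_div, abs_of_pos hN0]
  refine div_le_div_of_nonneg_right ?_ hN0.le
  push_cast at h2
  rw [abs_le] at h2 ⊢
  split_ifs at h2 <;> constructor <;> linarith

/-! ### Growth of `t_n` and passage to the logarithm -/

theorem IsRoots.lam_mul_le (hr : IsRoots k L β b) (h : IsParam k L β) (n : ℕ) :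
    |(lsCount k L β n 0 : ℝ) - ‖lam k L β b 1 0‖ * β⁻¹ ^ n|
      ≤ ∑ p ∈ Finset.Icc 2 k, ‖lam k L β b p 0‖ * ‖b p‖⁻¹ ^ n := by
  have h1 := h.lsCount_eq hr.root hr.inj hr.first (Nat.zero_le k) n
  have h2 : (0 : ℝ) ≤ β⁻¹ ^ n := pow_nonneg (inv_nonneg.2 h.pos.le) n
  have h3 : ‖lam k L β b 1 0‖ * β⁻¹ ^ n = ‖lam k L β b 1 0 * ((β⁻¹ ^ n : ℝ) : ℂ)‖ := by
    rw [norm_mul, Complex.norm_real, Real.norm_eq_abs, abs_of_nonneg h2]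
  rw [h3, ← Complex.norm_natCast]
  refine (abs_norm_sub_norm_le _ _).trans ?_
  rw [h1, add_sub_cancel_left]
  refine (norm_sum_le _ _).trans (Finset.sum_le_sum fun p _ => ?_)
  rw [norm_mul, norm_pow, norm_inv]

theorem IsRoots.tendsto_remainder (hr : IsRoots k L β b) :
    Tendsto (fun n => ∑ p ∈ Finset.Icc 2 k, ‖lam k L β b p 0‖ * ‖b p‖⁻¹ ^ n) atTop (𝓝 0) := by
  have key := tendsto_finsetSum (Finset.Icc 2 k) fun p hp =>
    (tendsto_pow_atTop_nhds_zero_of_lt_one (inv_nonneg.2 (norm_nonneg _))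
      (hr.inv_lt_one hp)).const_mul ‖lam k L β b p 0‖
  simpa only [mul_zero, Finset.sum_const_zero] using key

/-- Otherwise `t_n` would be a combination of decaying powers and tend to 0, although `t_n ≥ 1`. -/
theorem IsRoots.lam_ne_zero (hr : IsRoots k L β b) (h : IsParam k L β) :
    lam k L β b 1 0 ≠ 0 := by
  intro h0
  obtain ⟨n, hn⟩ := (hr.tendsto_remainder.eventually_lt_const one_pos).exists
  have h1 := (le_abs_self _).trans (hr.lam_mul_le h n)
  rw [h0, norm_zero, zero_mul, sub_zero] at h1
  have h2 : (1 : ℝ) ≤ lsCount k L β n 0 := by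
    have := h.lt_lsCount_total n
    exact_mod_cast (show 1 ≤ lsCount k L β n 0 by omega)
  linarith

theorem IsParam.tendsto_topIndex (h : IsParam k L β) :
    Tendsto (topIndex (lsCount k L β)) atTop atTop := by
  refine tendsto_atTop.2 fun m => ?_
  filter_upwards [eventually_ge_atTop (lsCount k L β m 0)] with N hN
  exact Nat.le_findGreatest (P := fun m => lsCount k L β m 0 ≤ N)
    ((h.lt_lsCount_total m).le.trans hN) hN

/-- Once the remainder is below 1, `|λ_{1,0}| β ^ (-n) ≤ t_n + 1 ≤ N + 1`; take logarithms. This is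
the origin of `N + 1`, while `β ^ k` accounts for the `k` extra levels. -/
theorem IsRoots.eventually_levels (hr : IsRoots k L β b) (h : IsParam k L β) :
    ∀ᶠ N : ℕ in atTop, (((topIndex (lsCount k L β) N + k : ℕ) : ℝ)) * |Real.log β|
      ≤ Real.log ((N : ℝ) + 1) - Real.log ‖lam k L β b 1 0 * (β : ℂ) ^ k‖ := by
  have hlam := norm_pos_iff.2 (hr.lam_ne_zero h)
  have hlog := Real.log_neg h.pos h.lt_one
  filter_upwards [h.tendsto_topIndex.eventually (hr.tendsto_remainder.eventually_lt_const one_pos),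
    eventually_ge_atTop 1] with N hN hN1
  have h1 := (neg_le_abs _).trans (hr.lam_mul_le h (topIndex (lsCount k L β) N))
  have h2 : (lsCount k L β (topIndex (lsCount k L β) N) 0 : ℝ) ≤ N := by
    exact_mod_cast h.topIndex_le hN1
  generalize topIndex (lsCount k L β) N = n at *
  have h3 : ‖lam k L β b 1 0‖ * β⁻¹ ^ n ≤ N + 1 := by linarith
  have h4 := Real.log_le_log (mul_pos hlam (pow_pos (inv_pos.2 h.pos) n)) h3
  rw [Real.log_mul hlam.ne' (pow_pos (inv_pos.2 h.pos) n).ne', Real.log_pow, Real.log_inv] at h4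
  rw [norm_mul, norm_pow, Complex.norm_real, Real.norm_eq_abs, abs_of_pos h.pos,
    Real.log_mul hlam.ne' (pow_pos h.pos k).ne', Real.log_pow, abs_of_neg hlog]
  push_cast
  linarith

theorem IsRoots.discrepancy_le (hr : IsRoots k L β b) (h : IsParam k L β) :
    ∀ᶠ N : ℕ in atTop, discrepancy (lsPoint k L β) N ≤
        (Real.log ((N : ℝ) + 1) - Real.log ‖lam k L β b 1 0 * (β : ℂ) ^ k‖)
            / ((N : ℝ) * |Real.log β|) * levelFactor k L * bigR k L β b := by
  have hR : 0 ≤ bigR k L β b - 1 := by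
    have := hr.lsCount_mul_le_bigR h 0
    have := h.one_le_lsCount_mul 0
    linarith
  have hK := h.one_le_levelFactor
  have hlog : 0 < |Real.log β| := abs_pos.2 (Real.log_neg h.pos h.lt_one).ne
  filter_upwards [hr.eventually_levels h, eventually_ge_atTop 1, (tendsto_natCast_atTop_atTop.comp
    h.tendsto_topIndex).eventually_ge_atTop (2 * (bigR k L β b - 1) + 1)] with N h1 h2 h3
  have h4 := hr.mul_discrepancy_le h h2 (h.lt_topIndex N)
  simp only [Function.comp_apply] at h3
  generalize topIndex (lsCount k L β) N = n at *
  have hN0 : (0 : ℝ) < N := by exact_mod_cast h2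
  refine h4.trans ?_
  rw [div_mul_eq_mul_div, div_mul_eq_mul_div, div_le_div_iff₀ hN0 (mul_pos hN0 hlog)]
  push_cast at h1
  -- Replacing `R̃ - 1` by `R̃` gains `(n + k) * levelFactor ≥ n`, which exceeds the bounded
  -- leftover for large `N`.
  have h5 : (n + k) * (levelFactor k L * (bigR k L β b - 1)) + (2 * (bigR k L β b - 1) + 1)
      ≤ (n + k) * (levelFactor k L * bigR k L β b) := by
    have h6 : (n + k : ℝ) * 1 ≤ (n + k) * levelFactor k L :=
      mul_le_mul_of_nonneg_left hK (by positivity)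
    have h7 : (0 : ℝ) ≤ k := Nat.cast_nonneg k
    linarith
  have h8 : 0 ≤ levelFactor k L * bigR k L β b := mul_nonneg (by linarith) (by linarith)
  have h9 := mul_le_mul_of_nonneg_right h1 h8
  have h10 := mul_le_mul_of_nonneg_right h5 (mul_pos hN0 hlog).le
  have h11 := mul_le_mul_of_nonneg_right h9 hN0.le
  linarith

theorem discrepancy_nonneg (x : ℕ → ℝ) (N : ℕ) : 0 ≤ discrepancy x N :=
  Real.sSup_nonneg (by rintro _ ⟨u, v, -, -, -, rfl⟩; exact abs_nonneg _)

theorem isBigO_of_le_log {f : ℕ → ℝ} (hf : ∀ N, 0 ≤ f N) {A B C D : ℝ}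
    (h : ∀ᶠ N : ℕ in atTop, f N ≤ (Real.log ((N : ℝ) + 1) - A) / ((N : ℝ) * B) * C * D) :
    f =O[atTop] fun N : ℕ => Real.log (N : ℝ) / (N : ℝ) := by
  refine Asymptotics.IsBigO.of_bound ((2 + |A|) * (|B|⁻¹ * |C| * |D|)) ?_
  -- Since `3 > e`, this gives `log N ≥ 1`, so the constant `A` can be absorbed into a multiple of
  -- `log N`.
  filter_upwards [h, eventually_ge_atTop 3] with N hN h3
  have h3' : (3 : ℝ) ≤ N := by exact_mod_cast h3
  have hlog : 1 ≤ Real.log N := by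
    rw [Real.le_log_iff_exp_le (by linarith)]
    linarith [Real.exp_one_lt_d9]
  have h1 : Real.log ((N : ℝ) + 1) ≤ 2 * Real.log N := by
    have := Real.log_le_log (show (0 : ℝ) < N + 1 by linarith)
      (show (N : ℝ) + 1 ≤ (N : ℝ) ^ 2 by nlinarith)
    rwa [Real.log_pow, Nat.cast_ofNat] at this
  have h0 : 0 ≤ Real.log ((N : ℝ) + 1) := Real.log_nonneg (by linarith)
  have h2 : |Real.log ((N : ℝ) + 1) - A| ≤ (2 + |A|) * Real.log N := by
    refine (abs_sub _ _).trans ?_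
    rw [abs_of_nonneg h0]
    nlinarith [abs_nonneg A]
  have hN0 : (0 : ℝ) < N := by linarith
  rw [Real.norm_eq_abs, Real.norm_eq_abs, abs_of_nonneg (hf N),
    abs_of_nonneg (div_nonneg (by linarith) hN0.le)]
  refine hN.trans ((le_abs_self _).trans ?_)
  rw [abs_mul, abs_mul, abs_div, abs_mul, Nat.abs_cast]
  calc _ = |Real.log ((N : ℝ) + 1) - A| * (|B|⁻¹ * |C| * |D| / N) := by
        rw [div_eq_mul_inv, mul_inv]
        ring
    _ ≤ ((2 + |A|) * Real.log N) * (|B|⁻¹ * |C| * |D| / N) :=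
        mul_le_mul_of_nonneg_right h2 (by positivity)
    _ = _ := by ring

end GenLS

theorem theorem2 (k : ℕ) (L : ℕ → ℕ) (hk : 1 ≤ k) (hL1 : L 1 ≠ 0) (hLk : L k ≠ 0)
    (β : ℝ) (hβ0 : 0 < β) (hβ1 : β < 1)
    (b : ℕ → ℂ) (hb : (GenLS.lsPoly k L).roots = (Finset.Icc 1 k).val.map b)
    (hsimple : (GenLS.lsPoly k L).roots.Nodup)
    (hb1 : b 1 = (β : ℂ)) (hbj : ∀ j ∈ Finset.Icc 2 k, 1 < ‖b j‖) :
    (∀ᶠ N : ℕ in Filter.atTop,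
      GenLS.discrepancy (GenLS.lsPoint k L β) N ≤
        (Real.log ((N : ℝ) + 1) - Real.log ‖GenLS.lam k L β b 1 0 * (β : ℂ) ^ k‖)
            / ((N : ℝ) * |Real.log β|)
          * (2 * (L 1 : ℝ) + (∑ i ∈ Finset.Icc 2 k, (L i : ℝ)) - 2)
          * GenLS.bigR k L β b) ∧
    (fun N : ℕ => GenLS.discrepancy (GenLS.lsPoint k L β) N)
      =O[Filter.atTop] (fun N : ℕ => Real.log (N : ℝ) / (N : ℝ)) := by
  have hroot : ∀ j ∈ Finset.Icc 1 k, ∑ i ∈ Finset.Icc 1 k, (L i : ℂ) * b j ^ i = 1 :=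
    fun j hj => GenLS.sum_eq_one_of_roots hb hj
  have h := GenLS.isParam_of_roots hk hL1 hβ0 hβ1 hroot hb1
  have hr : GenLS.IsRoots k L β b := ⟨hroot, GenLS.injOn_of_roots hb hsimple, hb1, hbj⟩
  have hle := hr.discrepancy_le h
  exact ⟨hle, GenLS.isBigO_of_le_log (fun N => GenLS.discrepancy_nonneg _ N) hle⟩
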